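/- **Model.** There are $n$ processes $1,\dots,n$, each pair connected by a private authenticated asynchronous channel with arbitrary finite delays. An adaptive adversary schedules all steps and may, during the execution, take control of at most $t$ processes; on doing so it learns their whole memory and from then on sends messages in their name. A process is *correct* if it is never controlled and *faulty* otherwise; a *faulty pair* is an unordered pair of processes of which at least one is faulty. All values lie in a field $K$ in which $0,1,\dots,n$ are distinct. "Degree-$t$" means of degree at most $t$ (in each variable). Each correct process passes through rounds $1,2,\dots$, and any number of instances of IVSS[$r$], for all $r\ge 1$, are run concurrently with the certification protocol; an instance is named by its round, its dealer and a counter. The instances of IVSS[$r$] are run in round $r$: a process *keeps participating* in a protocol of an instance of round $r$ if it begins it in round $r$ and follows it, staying in that round, until completion. A-Cast is Bracha's broadcast protocol, which all correct processes always run: the sender sends $(\mathrm{msg},u)$ to all; a process sends one $(\mathrm{echo},u)$ on receiving $(\mathrm{msg},u)$ from the sender, one $(\mathrm{ready},u)$ on receiving $n-t$ $(\mathrm{echo},u)$ or $t+1$ $(\mathrm{ready},u)$, and outputs $u$ on receiving $2t+1$ $(\mathrm{ready},u)$. Below, "receives" refers to the output of an A-Cast where the item was A-Cast. **Sharing, IVSS[$r$]-$\mathcal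 S$.** (1) The dealer, with secret $s$, picks a uniformly random symmetric bivariate degree-$t$ polynomial $f$ with $f(0,0)=s$ and sends $f_i=f(i,\cdot)$ to each process $i$. (2) A process $k$ that received $\hat f_k$ from the dealer sends $\hat f_k(i)$ to each $i$. (3) If the value $k$ received from $i$ equals $\hat f_k(i)$, then $k$ A-Casts "equal: $(k,i)$". (4) If for a set $\mathcal M$ of $n-t$ processes the dealer has received "equal: $(i,j)$" from $i$ and "checked$_r$: $p,q,\{i,j\}$" from $p$ for all $i,j,p,q\in\mathcal M$, it A-Casts (one such) $\mathcal M$. (5) A process that received $\mathcal M$ from the dealer and the same messages completes $\mathcal S$. **Reconstruction, IVSS[$r$]-$\mathcal R$** (called only after $\mathcal S$ is completed). (1) Each $k\in\mathcal M$ A-Casts $\hat f_k$. (2) If there are $IS_k\subseteq\mathcal M$ with $|IS_k|=n-2t$ and a symmetric bivariate degree-$t$ polynomial $\bar f$ such that $k$ received a polynomial $\tilde f_i$ from every $i\in IS_k$ and $\bar f(i,j)=\tilde f_i(j)$ for all $i\in IS_k$, $j\in\mathcal M$, then $k$ sets $v_k=\bar f(0,0)$, A-Casts "ready to complete" and adds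 the instance to $\mathrm{CoreInvocations}^k_r$. (3) If $k$ has done (2) and received "ready to complete" from $n-t$ processes, it outputs $v_k$ and completes $\mathcal R$. **Certification.** (a) At the beginning of round $r+1$, process $k$ A-Casts $\mathrm{CoreInvocations}^k_r$ ($\mathrm{CoreInvocations}^k_0=\varnothing$). (b) If $k$ has received $\mathrm{CoreInvocations}^l_r$, from some $l$, containing an instance of round $r$, and has received $\mathcal M$ of that instance and, in Step 1 of $\mathcal R$ of that instance, polynomials $\tilde f_i,\tilde f_j$ from $i,j\in\mathcal M$ with $\tilde f_i(j)\ne\tilde f_j(i)$, then $k$ *infers* the pair $\{i,j\}$ from that instance and puts it into $FP_k$. (c) If $k$ has received $\mathrm{CoreInvocations}^l_r$ containing an instance of round $r$, it executes $\mathcal S$ and Step 1 of $\mathcal R$ of that instance, in whatever round it is. (d) If $k$ has received $\mathrm{CoreInvocations}^l_{r'}$ for all $r'<r$, has for every instance in these sets received $\mathcal M$ and the polynomials A-Cast in Step 1 of $\mathcal R$ by those of $i,j$ that are in $\mathcal M$, and $\{i,j\}\notin FP_k$, then $k$ A-Casts "checked$_r$: $k,l,\{i,j\}$". **Theorem.**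 Let $n>3t$ and $r\ge1$, and let $\mathbb I$ be any instance of IVSS[$r$]. In every execution in which messages to correct processes are eventually delivered and correct processes eventually execute the steps that stay enabled: * *Termination.* (1) If the dealer is correct and starts $\mathcal S$, and all correct processes keep participating in $\mathcal S$, then every correct process eventually completes $\mathcal S$. (2) If some correct process completes $\mathcal S$, then every correct process that keeps participating in $\mathcal S$ eventually completes $\mathcal S$. (3) If some correct process completes $\mathcal S$ and all correct processes begin and keep participating in $\mathcal R$, then every correct process eventually completes $\mathcal R$. (4) If some correct process completes $\mathcal R$, then every correct process that keeps participating in $\mathcal R$ eventually completes $\mathcal R$. * *Correctness.* At every time at which some not yet controlled process has completed $\mathcal S$ there is a value $v$, fixed by the execution so far, such that in every continuation: (1) if every correct process eventually begins round $r+1$, then either every correct process that completes $\mathcal R$ outputs $v$, or there is a nonempty set $P$ of faulty pairs such that every correct process eventually infers all pairs in $P$ from $\mathbb I$, no pair in $P$ is ever inferred by a correct process from an instance of an earlier round whose reconstruction is completed by some correct process (the pairs are new), and, if every process in $\mathcal M$ eventually A-Casts a polynomial in Step 1 of $\mathcal R$, $|P|\ge t(n-3t)$; (2) if the dealer is correct,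 then $v=s$. * *Secrecy.* If $K$ is finite, then for every adversary, every two values of the secret of $\mathbb I$ (the secrets of all other instances being the same), every number of steps $N$ and every view $w$, the probability that after $N$ steps the adversary's view is $w$, the dealer of $\mathbb I$ is not controlled and no uncontrolled process has executed Step 1 of $\mathcal R$ of $\mathbb I$ (on a call or by (c)) is the same for both values. That is, as long as the dealer is correct and no correct process has begun $\mathcal R$, the view carries no information about the secret. -/

import Mathlib

namespace IVSS

open Classical

noncomputable section

/-! ### Polynomials, instances and messages -/

/-- A univariate polynomial of degree at most `t` over `K`, given by its coefficients. -/
abbrev UPoly (t : ℕ) (K : Type) : Type := Fin (t + 1) → K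

/-- A symmetric bivariate polynomial of degree at most `t` in each variable, given by its
coefficients: `a s(p, q)` is the coefficient of `x ^ p * y ^ q` and of `x ^ q * y ^ p`. -/
abbrev SPoly (t : ℕ) (K : Type) : Type := Sym2 (Fin (t + 1)) → K

/-- The value `f(x)`. -/
def UPoly.eval {t : ℕ} {K : Type} [Field K] (f : UPoly t K) (x : K) : K :=
  ∑ p : Fin (t + 1), f p * x ^ (p : ℕ)

/-- The value `f(x, y)`. -/
def SPoly.eval {t : ℕ} {K : Type} [Field K] (a : SPoly t K) (x y : K) : K :=
  ∑ p : Fin (t + 1), ∑ q : Fin (t + 1), a s(p, q) * x ^ (p : ℕ) * y ^ (q : ℕ)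

/-- The univariate polynomial `y ↦ f(x, y)`. -/
def SPoly.slice {t : ℕ} {K : Type} [Field K] (a : SPoly t K) (x : K) : UPoly t K :=
  fun q => ∑ p : Fin (t + 1), a s(p, q) * x ^ (p : ℕ)

/-- Replace the constant coefficient by `s`. If `a` is uniformly distributed, the result is uniformly
distributed among the symmetric polynomials `f` of degree at most `t` with `f(0, 0) = s`. -/
def SPoly.withSecret {t : ℕ} {K : Type} (a : SPoly t K) (s : K) : SPoly t K :=
  Function.update a s(0, 0) s

/-- The processes are `Fin n`; process `i : Fin n` has the identifier `i + 1 ∈ {1, …, n}`, and this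
is its evaluation point. -/
def pt {n : ℕ} (K : Type) [Field K] (i : Fin n) : K := (((i : ℕ) + 1 : ℕ) : K)

/-- The name of an invocation of IVSS[`round`]: its round, its dealer and an invocation counter. -/
structure Inst (n : ℕ) where
  round : ℕ
  dealer : Fin n
  idx : ℕ

/-- The headings under which processes A-Cast. Each process A-Casts at most once under each of them. -/
inductive Tag (n : ℕ) where
  /-- `equal: (k, i)`, where `k` is the sender -/
  | equal (I : Inst n) (i : Fin n)
  /-- the candidate set of `I` -/
  | cand (I : Inst n)
  /-- the polynomial A-Cast in Step 1 of the reconstruction protocol -/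
  | poly (I : Inst n)
  /-- `ready to complete` -/
  | ready (I : Inst n)
  /-- `CoreInvocations_r` -/
  | core (r : ℕ)
  /-- `checked_r : k, l, {i, j}`, where `k` is the sender and `e = {i, j}` -/
  | checked (r : ℕ) (l : Fin n) (e : Sym2 (Fin n))

/-- The contents of an A-Cast. -/
inductive Val (n t : ℕ) (K : Type) where
  | unit
  | procs (M : Finset (Fin n))
  | poly (f : UPoly t K)
  | insts (S : Finset (Inst n))

/-- Messages on the point-to-point channels. The last three are the messages of the A-Cast protocol
with sender `o`, heading `g` and content `v`. -/
inductive Msg (n t : ℕ) (K : Type) where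
  /-- the polynomial that the dealer sends -/
  | row (I : Inst n) (f : UPoly t K)
  /-- the value of one's own polynomial at the recipient -/
  | share (I : Inst n) (x : K)
  | acMsg (o : Fin n) (g : Tag n) (v : Val n t K)
  | acEcho (o : Fin n) (g : Tag n) (v : Val n t K)
  | acReady (o : Fin n) (g : Tag n) (v : Val n t K)

structure Packet (n t : ℕ) (K : Type) where
  src : Fin n
  dst : Fin n
  msg : Msg n t K

/-- `m` sent by `k` to all processes, itself included. -/
def toAll {n t : ℕ} {K : Type} (k : Fin n) (m : Msg n t K) : List (Packet n t K) :=
  (List.finRange n).map fun j => ⟨k, j, m⟩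

/-! ### The code of one process -/

/-- The local memory of a process. -/
structure Local (n t : ℕ) (K : Type) where
  /-- current round, `0` before the start -/
  round : ℕ
  /-- received messages, with their senders -/
  rcvd : Set (Fin n × Msg n t K)
  /-- the A-Casts that this process has initiated -/
  cast : Tag n → Option (Val n t K)
  /-- the `echo`, `ready` and output of this process in the A-Cast of a sender under a heading -/
  echoed : Fin n → Tag n → Option (Val n t K)
  readied : Fin n → Tag n → Option (Val n t K)
  accepted : Fin n → Tag n → Option (Val n t K)
  /-- the bivariate polynomial this process chose as the dealer of an instance -/
  dealt : Inst n → Option (SPoly t K)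
  /-- the (first) polynomial received from the dealer of an instance -/
  row : Inst n → Option (UPoly t K)
  /-- instances whose sharing (reconstruction) protocol this process participates in -/
  inS : Set (Inst n)
  inR : Set (Inst n)
  /-- instances for which the values of `row` have been sent out -/
  shared : Set (Inst n)
  /-- instances whose sharing protocol has been completed -/
  doneS : Set (Inst n)
  /-- the value set in Step 2 of the reconstruction protocol -/
  value : Inst n → Option K
  /-- the union of the sets `CoreInvocations_r`, over all `r` -/
  core : Finset (Inst n)
  /-- the output of the reconstruction protocol, present iff that protocol has been completed -/
  output : Inst n → Option K

def Local.start (n t : ℕ) (K : Type) : Local n t K where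
  round := 0
  rcvd := ∅
  cast := fun _ => none
  echoed := fun _ _ => none
  readied := fun _ _ => none
  accepted := fun _ _ => none
  dealt := fun _ => none
  row := fun _ => none
  inS := ∅
  inR := ∅
  shared := ∅
  doneS := ∅
  value := fun _ => none
  core := ∅
  output := fun _ => none

section Code

variable {n t : ℕ} {K : Type} [Field K]

/-- Receiving the message `m` from `src`. -/
def Local.receive (L : Local n t K) (src : Fin n) (m : Msg n t K) : Local n t K :=
  let L' := { L with rcvd := insert (src, m) L.rcvd }
  match m with
  | .row I f =>
      if src = I.dealer ∧ L.row I = none then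
        { L' with row := Function.update L.row I (some f) }
      else L'
  | _ => L'

/-- The number of processes from which the message `m` has been received. -/
def Local.count (L : Local n t K) (m : Msg n t K) : ℕ := {j : Fin n | (j, m) ∈ L.rcvd}.ncard

/-- Process `k` initiates an A-Cast of `v` under the heading `g`. -/
def Local.acast (L : Local n t K) (k : Fin n) (g : Tag n) (v : Val n t K) :
    Local n t K × List (Packet n t K) :=
  ({ L with cast := Function.update L.cast g (some v) }, toAll k (.acMsg k g v))

/-- The process has received `CoreInvocations_r` from `l`, with `r` the round of `I`, and `I` is in
that set. -/
def Local.ReportedBy (L : Local n t K) (l : Fin n) (I : Inst n) : Prop :=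
  ∃ S, L.accepted l (.core I.round) = some (.insts S) ∧ I ∈ S

def Local.Reported (L : Local n t K) (I : Inst n) : Prop := ∃ l, L.ReportedBy l I

/-- The process has received the candidate set `M` of `I` from the dealer. -/
def Local.HasCand (L : Local n t K) (I : Inst n) (M : Finset (Fin n)) : Prop :=
  L.accepted I.dealer (.cand I) = some (.procs M)

/-- The process has received the polynomial `f` that `i` A-Cast in the reconstruction of `I`. -/
def Local.HasPoly (L : Local n t K) (I : Inst n) (i : Fin n) (f : UPoly t K) : Prop :=
  L.accepted i (.poly I) = some (.poly f)

/-- The process takes part in the sharing protocol of `I` on its own account. The instances of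
IVSS[`r`] are run in round `r`. -/
def Local.PartS (L : Local n t K) (I : Inst n) : Prop := I ∈ L.inS ∧ L.round = I.round

/-- The process takes part in the reconstruction protocol of `I` on its own account. -/
def Local.PartR (L : Local n t K) (I : Inst n) : Prop := I ∈ L.inR ∧ L.round = I.round

/-- The conditions on a candidate set in Steps 4 and 5 of the sharing protocol. -/
def Local.GoodCand (L : Local n t K) (I : Inst n) (M : Finset (Fin n)) : Prop :=
  M.card = n - t ∧
  (∀ i ∈ M, ∀ j ∈ M, L.accepted i (.equal I j) = some .unit) ∧
  (∀ i ∈ M, ∀ j ∈ M, ∀ p ∈ M, ∀ q ∈ M, L.accepted p (.checked I.round q s(i, j)) = some .unit)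

/-- The process infers the faulty pair `e` from the instance `I` (certification protocol). -/
def Local.Infers (L : Local n t K) (I : Inst n) (e : Sym2 (Fin n)) : Prop :=
  L.Reported I ∧ ∃ M, L.HasCand I M ∧ ∃ i ∈ M, ∃ j ∈ M, ∃ fi fj,
    e = s(i, j) ∧ L.HasPoly I i fi ∧ L.HasPoly I j fj ∧ fi.eval (pt K j) ≠ fj.eval (pt K i)

/-- The set `FP` of the faulty pairs that the process has inferred. -/
def Local.FP (L : Local n t K) : Set (Sym2 (Fin n)) := {e | ∃ I, L.Infers I e}

/-- The calls that a process receives from the higher-level protocol. -/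
inductive Call (n : ℕ) where
  /-- begin the next round -/
  | nextRound
  /-- act as the dealer of `I` -/
  | deal (I : Inst n)
  /-- begin (stop) participating in the sharing protocol of `I` -/
  | joinS (I : Inst n)
  | leaveS (I : Inst n)
  /-- begin (stop) participating in the reconstruction protocol of `I` -/
  | joinR (I : Inst n)
  | leaveR (I : Inst n)

/-- When process `k` can be called. Rounds are numbered from `1`; the reconstruction protocol is only
called when the sharing protocol is completed. -/
def Call.Guard (k : Fin n) (L : Local n t K) : Call n → Prop
  | .nextRound => True
  | .deal I => k = I.dealer ∧ 1 ≤ I.round ∧ L.round = I.round ∧ L.dealt I = none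
  | .joinS I => 1 ≤ I.round ∧ L.round = I.round
  | .leaveS _ => True
  | .joinR I => 1 ≤ I.round ∧ L.round = I.round ∧ I ∈ L.doneS
  | .leaveR _ => True

/-- The effect of a call on process `k`: its new memory and the messages it sends. The dealer of `I`
has the secret `sec I`; `a` is the source of its randomness. At the beginning of round `r + 1` the
process A-Casts `CoreInvocations_r`. -/
def Call.run (sec : Inst n → K) (a : SPoly t K) (k : Fin n) (L : Local n t K) :
    Call n → Local n t K × List (Packet n t K)
  | .nextRound =>
      { L with round := L.round + 1 }.acast k (.core L.round)
        (.insts (L.core.filter fun I => I.round = L.round))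
  | .deal I =>
      let f := a.withSecret (sec I)
      ({ L with dealt := Function.update L.dealt I (some f), inS := insert I L.inS },
        (List.finRange n).map fun i => ⟨k, i, .row I (f.slice (pt K i))⟩)
  | .joinS I => ({ L with inS := insert I L.inS }, [])
  | .leaveS I => ({ L with inS := L.inS \ {I} }, [])
  | .joinR I => ({ L with inR := insert I L.inR }, [])
  | .leaveR I => ({ L with inR := L.inR \ {I} }, [])

/-- The steps of the protocols. -/
inductive Rule (n t : ℕ) (K : Type) where
  /-- A-Cast: send `echo` -/
  | echo (o : Fin n) (g : Tag n) (v : Val n t K)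
  /-- A-Cast: send `ready` -/
  | ready (o : Fin n) (g : Tag n) (v : Val n t K)
  /-- A-Cast: output -/
  | accept (o : Fin n) (g : Tag n) (v : Val n t K)
  /-- sharing, Step 2 -/
  | share (I : Inst n)
  /-- sharing, Step 3 -/
  | equal (I : Inst n) (i : Fin n)
  /-- sharing, Step 4 -/
  | candidate (I : Inst n) (M : Finset (Fin n))
  /-- sharing, Step 5 -/
  | completeS (I : Inst n)
  /-- reconstruction, Step 1 -/
  | reveal (I : Inst n)
  /-- reconstruction, Step 2, with interpolation set `IS` and interpolating polynomial `f` -/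
  | interpolate (I : Inst n) (IS : Finset (Fin n)) (f : SPoly t K)
  /-- reconstruction, Step 3 -/
  | finish (I : Inst n)
  /-- certification: A-Cast `checked` -/
  | certify (r : ℕ) (l i j : Fin n)

/-- When process `k` can execute a step. The steps of the sharing protocol and Step 1 of the
reconstruction protocol are also executed for the reported instances (as the certification protocol
demands). Every step is executed at most once. -/
def Rule.Guard (k : Fin n) (L : Local n t K) : Rule n t K → Prop
  | .echo o g v => L.echoed o g = none ∧ (o, .acMsg o g v) ∈ L.rcvd
  | .ready o g v => L.readied o g = none ∧
      (n - t ≤ L.count (.acEcho o g v) ∨ t + 1 ≤ L.count (.acReady o g v))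
  | .accept o g v => L.accepted o g = none ∧ 2 * t + 1 ≤ L.count (.acReady o g v)
  | .share I => (L.PartS I ∨ L.Reported I) ∧ I ∉ L.shared ∧ L.row I ≠ none
  | .equal I i => (L.PartS I ∨ L.Reported I) ∧ L.cast (.equal I i) = none ∧
      ∃ f x, L.row I = some f ∧ (i, .share I x) ∈ L.rcvd ∧ f.eval (pt K i) = x
  | .candidate I M => (L.PartS I ∨ L.Reported I) ∧ L.cast (.cand I) = none ∧
      k = I.dealer ∧ L.dealt I ≠ none ∧ L.GoodCand I M
  | .completeS I => (L.PartS I ∨ L.Reported I) ∧ I ∉ L.doneS ∧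
      ∃ M, L.HasCand I M ∧ L.GoodCand I M
  | .reveal I => (L.PartR I ∨ L.Reported I) ∧ I ∈ L.doneS ∧ L.cast (.poly I) = none ∧
      L.row I ≠ none ∧ ∃ M, L.HasCand I M ∧ k ∈ M
  | .interpolate I IS f => L.PartR I ∧ L.value I = none ∧
      ∃ M, L.HasCand I M ∧ IS ⊆ M ∧ IS.card = n - 2 * t ∧
        ∀ i ∈ IS, ∃ fi, L.HasPoly I i fi ∧ ∀ j ∈ M, f.eval (pt K i) (pt K j) = fi.eval (pt K j)
  | .finish I => L.PartR I ∧ L.output I = none ∧ L.value I ≠ none ∧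
      n - t ≤ {j : Fin n | L.accepted j (.ready I) = some .unit}.ncard
  | .certify r l i j => L.cast (.checked r l s(i, j)) = none ∧
      (∀ r' < r, ∃ S, L.accepted l (.core r') = some (.insts S)) ∧
      (∀ I : Inst n, I.round < r → L.ReportedBy l I → ∃ M, L.HasCand I M ∧
        (i ∈ M → ∃ f, L.HasPoly I i f) ∧ (j ∈ M → ∃ f, L.HasPoly I j f)) ∧
      s(i, j) ∉ L.FP

/-- The effect of a step of process `k`: its new memory and the messages it sends. -/
def Rule.run (k : Fin n) (L : Local n t K) : Rule n t K → Local n t K × List (Packet n t K)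
  | .echo o g v =>
      ({ L with echoed := Function.update L.echoed o (Function.update (L.echoed o) g (some v)) },
        toAll k (.acEcho o g v))
  | .ready o g v =>
      ({ L with readied := Function.update L.readied o (Function.update (L.readied o) g (some v)) },
        toAll k (.acReady o g v))
  | .accept o g v =>
      ({ L with accepted :=
          Function.update L.accepted o (Function.update (L.accepted o) g (some v)) }, [])
  | .share I =>
      match L.row I with
      | some f => ({ L with shared := insert I L.shared },
          (List.finRange n).map fun i => ⟨k, i, .share I (f.eval (pt K i))⟩)
      | none => (L, [])
  | .equal I i => L.acast k (.equal I i) .unit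
  | .candidate I M => L.acast k (.cand I) (.procs M)
  | .completeS I => ({ L with doneS := insert I L.doneS }, [])
  | .reveal I =>
      match L.row I with
      | some f => L.acast k (.poly I) (.poly f)
      | none => (L, [])
  | .interpolate I _ f =>
      { L with value := Function.update L.value I (some (f.eval 0 0)),
               core := insert I L.core }.acast k (.ready I) .unit
  | .finish I => ({ L with output := Function.update L.output I (L.value I) }, [])
  | .certify r l i j => L.acast k (.checked r l s(i, j)) .unit

end Code

/-! ### The network and the adversary -/

/-- A global state: the processes controlled by the adversary, the memories, and the list of all
messages sent so far. -/
structure State (n t : ℕ) (K : Type) where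
  corrupted : Finset (Fin n)
  loc : Fin n → Local n t K
  net : List (Packet n t K)

def State.start (n t : ℕ) (K : Type) : State n t K where
  corrupted := ∅
  loc := fun _ => Local.start n t K
  net := []

/-- What the adversary, who also is the scheduler, can do in one step of the system: take control of a
process; send a message in the name of a controlled process; deliver the `m`-th message that has been
sent; let an uncontrolled process be called; let an uncontrolled process execute a step of its code. -/
inductive Cmd (n t : ℕ) (K : Type) where
  | corrupt (i : Fin n)
  | inject (p : Packet n t K)
  | deliver (m : ℕ)
  | call (k : Fin n) (c : Call n)
  | rule (k : Fin n) (ρ : Rule n t K)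

section System

variable {n t : ℕ} {K : Type} [Field K]

/-- At most `t` processes are ever controlled by the adversary. -/
def Cmd.Enabled (σ : State n t K) : Cmd n t K → Prop
  | .corrupt i => i ∉ σ.corrupted ∧ σ.corrupted.card < t
  | .inject p => p.src ∈ σ.corrupted
  | .deliver m => m < σ.net.length
  | .call k c => k ∉ σ.corrupted ∧ c.Guard k (σ.loc k)
  | .rule k ρ => k ∉ σ.corrupted ∧ ρ.Guard k (σ.loc k)

/-- Process `k` changes its memory and sends messages. -/
def State.local (σ : State n t K) (k : Fin n) (x : Local n t K × List (Packet n t K)) :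
    State n t K :=
  { σ with loc := Function.update σ.loc k x.1, net := σ.net ++ x.2 }

/-- One step of the system; a command that is not enabled has no effect. -/
def exec (sec : Inst n → K) (a : SPoly t K) (σ : State n t K) (c : Cmd n t K) : State n t K :=
  if c.Enabled σ then
    match c with
    | .corrupt i => { σ with corrupted := insert i σ.corrupted }
    | .inject p => { σ with net := σ.net ++ [p] }
    | .deliver m =>
        match σ.net[m]? with
        | some p => σ.local p.dst ((σ.loc p.dst).receive p.src p.msg, [])
        | none => σ
    | .call k c => σ.local k (c.run sec a k (σ.loc k))
    | .rule k ρ => σ.local k (ρ.run k (σ.loc k))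
  else σ

end System

/-- An infinite execution of any number of instances of IVSS[`r`], for all `r`, together with the
certification protocol. `secret` holds the secrets of the dealers, `coin` their random choices. -/
structure Run (n t : ℕ) (K : Type) [Field K] where
  secret : Inst n → K
  coin : ℕ → SPoly t K
  cmd : ℕ → Cmd n t K
  st : ℕ → State n t K
  st_zero : st 0 = State.start n t K
  st_succ : ∀ τ, st (τ + 1) = exec secret (coin τ) (st τ) (cmd τ)

section Properties

variable {n t : ℕ} {K : Type} [Field K]

/-- The memory of process `k` at time `τ`. -/
def Run.at (R : Run n t K) (τ : ℕ) (k : Fin n) : Local n t K := (R.st τ).loc k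

/-- A process is correct if the adversary never takes control of it, and faulty otherwise. -/
def Run.Correct (R : Run n t K) (k : Fin n) : Prop := ∀ τ, k ∉ (R.st τ).corrupted

/-- One of the two processes of the pair is faulty. -/
def Run.FaultyPair (R : Run n t K) (e : Sym2 (Fin n)) : Prop := ∃ i ∈ e, ¬ R.Correct i

/-- Messages to correct processes are delivered after a finite time, and a correct process does not
forever delay a step that it can execute. -/
structure Run.Fair (R : Run n t K) : Prop where
  delivery : ∀ τ m p, (R.st τ).net[m]? = some p → R.Correct p.dst →
    ∃ τ', τ ≤ τ' ∧ R.cmd τ' = .deliver m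
  progress : ∀ k ρ τ, R.Correct k → (∀ τ', τ ≤ τ' → (Cmd.rule k ρ).Enabled (R.st τ')) →
    ∃ τ', τ ≤ τ' ∧ R.cmd τ' = .rule k ρ

def Run.CompletesS (R : Run n t K) (I : Inst n) (k : Fin n) : Prop := ∃ τ, I ∈ (R.at τ k).doneS

def Run.CompletesR (R : Run n t K) (I : Inst n) (k : Fin n) : Prop := ∃ τ, (R.at τ k).output I ≠ none

/-- `k` begins the sharing protocol of `I` and follows it until completion. -/
def Run.KeepsS (R : Run n t K) (I : Inst n) (k : Fin n) : Prop :=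
  ∃ τ, ∀ τ', τ ≤ τ' → (R.at τ' k).PartS I ∨ I ∈ (R.at τ' k).doneS

/-- `k` begins the reconstruction protocol of `I` and follows it until completion. -/
def Run.KeepsR (R : Run n t K) (I : Inst n) (k : Fin n) : Prop :=
  ∃ τ, ∀ τ', τ ≤ τ' → (R.at τ' k).PartR I ∨ (R.at τ' k).output I ≠ none

/-- The dealer of `I` starts the sharing protocol as the dealer. -/
def Run.Deals (R : Run n t K) (I : Inst n) : Prop := ∃ τ, (R.at τ I.dealer).dealt I ≠ none

def Termination1 (n t : ℕ) (K : Type) [Field K] (I : Inst n) : Prop :=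
  ∀ R : Run n t K, R.Fair → R.Correct I.dealer → R.Deals I →
    (∀ k, R.Correct k → R.KeepsS I k) → ∀ k, R.Correct k → R.CompletesS I k

def Termination2 (n t : ℕ) (K : Type) [Field K] (I : Inst n) : Prop :=
  ∀ R : Run n t K, R.Fair → (∃ k, R.Correct k ∧ R.CompletesS I k) →
    ∀ k, R.Correct k → R.KeepsS I k → R.CompletesS I k

def Termination3 (n t : ℕ) (K : Type) [Field K] (I : Inst n) : Prop :=
  ∀ R : Run n t K, R.Fair → (∃ k, R.Correct k ∧ R.CompletesS I k) →
    (∀ k, R.Correct k → R.KeepsR I k) → ∀ k, R.Correct k → R.CompletesR I k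

def Termination4 (n t : ℕ) (K : Type) [Field K] (I : Inst n) : Prop :=
  ∀ R : Run n t K, R.Fair → (∃ k, R.Correct k ∧ R.CompletesR I k) →
    ∀ k, R.Correct k → R.KeepsR I k → R.CompletesR I k

/-- Every correct process eventually begins the round after that of `I`. -/
def Run.RoundEnds (R : Run n t K) (I : Inst n) : Prop :=
  ∀ k, R.Correct k → ∃ τ, I.round < (R.at τ k).round

/-- Every process in the candidate set of `I` eventually A-Casts a polynomial in Step 1 of the
reconstruction protocol of `I`. -/
def Run.AllReveal (R : Run n t K) (I : Inst n) : Prop :=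
  ∀ k, R.Correct k → ∀ τ M, (R.at τ k).HasCand I M → ∀ i ∈ M, ∃ τ' f, (R.at τ' k).HasPoly I i f

/-- No correct process ever infers the pair `e` from an instance of an earlier round than that of `I`
that was reconstructed by some correct process. -/
def Run.NewPair (R : Run n t K) (I : Inst n) (e : Sym2 (Fin n)) : Prop :=
  ∀ J : Inst n, J.round < I.round → (∃ k, R.Correct k ∧ R.CompletesR J k) →
    ∀ k, R.Correct k → ∀ τ, ¬ (R.at τ k).Infers J e

/-- A nonempty set of new faulty pairs is eventually inferred from `I` by all correct processes; it has
at least `t (n - 3 t)` elements if no process of the candidate set withholds its polynomial. -/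
def Run.InfersNewPairs (R : Run n t K) (I : Inst n) : Prop :=
  ∃ P : Finset (Sym2 (Fin n)), P.Nonempty ∧
    (∀ e ∈ P, R.FaultyPair e ∧ R.NewPair I e) ∧
    (∀ k, R.Correct k → ∃ τ, ∀ e ∈ P, (R.at τ k).Infers I e) ∧
    (R.AllReveal I → t * (n - 3 * t) ≤ P.card)

/-- At each time `T` at which some process that is not (yet) faulty has completed the sharing protocol,
there is a value `v`, fixed at that time, with the required properties in all continuations `R'` of the
execution `R` from time `T` on. -/
def Correctness (n t : ℕ) (K : Type) [Field K] (I : Inst n) : Prop :=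
  ∀ (R : Run n t K) (T : ℕ), (∃ k, k ∉ (R.st T).corrupted ∧ I ∈ (R.at T k).doneS) →
    ∃ v : K, ∀ R' : Run n t K, R'.Fair → (∀ τ ≤ T, R'.st τ = R.st τ) →
      (R'.RoundEnds I →
        (∀ k, R'.Correct k → ∀ τ w, (R'.at τ k).output I = some w → w = v) ∨
          R'.InfersNewPairs I) ∧
      (R'.Correct I.dealer → v = R'.secret I)

/-- What the adversary observes in one step: whether the command was enabled and, after the step, the
complete memories of the controlled processes and the senders and recipients of all messages. -/
structure Obs (n t : ℕ) (K : Type) where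
  ok : Prop
  corrupted : Finset (Fin n)
  memory : Fin n → Option (Local n t K)
  traffic : List (Fin n × Fin n)

/-- An adversary chooses each command on the basis of what it has observed before. -/
abbrev Adversary (n t : ℕ) (K : Type) : Type := List (Obs n t K) → Cmd n t K

/-- One step of the execution with the adversary `A`, with the random choice `a`. -/
def playStep (sec : Inst n → K) (A : Adversary n t K) (x : State n t K × List (Obs n t K))
    (a : SPoly t K) : State n t K × List (Obs n t K) :=
  let c := A x.2
  let σ := exec sec a x.1 c
  (σ, x.2 ++ [{ ok := c.Enabled x.1
                corrupted := σ.corrupted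
                memory := fun i => if i ∈ σ.corrupted then some (σ.loc i) else none
                traffic := σ.net.map fun p => (p.src, p.dst) }])

/-- The state and the view of the adversary after `N` steps. -/
def play (sec : Inst n → K) (A : Adversary n t K) {N : ℕ} (coins : Fin N → SPoly t K) :
    State n t K × List (Obs n t K) :=
  (List.ofFn coins).foldl (playStep sec A) (State.start n t K, [])

/-- The dealer of `I` is correct and no correct process has executed Step 1 of the reconstruction
protocol of `I`. -/
def State.Sealed (σ : State n t K) (I : Inst n) : Prop :=
  I.dealer ∉ σ.corrupted ∧ ∀ k, k ∉ σ.corrupted → (σ.loc k).cast (.poly I) = none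

/-- The probability, over independent and uniform random choices of the dealers, that after `N` steps
the view of the adversary is `w` and `I` still is sealed. -/
def sealedViewProb [Fintype K] (sec : Inst n → K) (A : Adversary n t K) (N : ℕ) (I : Inst n)
    (w : List (Obs n t K)) : ENNReal :=
  (PMF.uniformOfFintype (Fin N → SPoly t K)).toOuterMeasure
    {coins | (play sec A coins).2 = w ∧ (play sec A coins).1.Sealed I}

/-- Perfect secrecy: as long as `I` is sealed, the distribution of the view of the adversary does not
depend on the secret of `I`. -/
def Secrecy (n t : ℕ) (K : Type) [Field K] [Fintype K] (I : Inst n) : Prop :=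
  ∀ (A : Adversary n t K) (sec sec' : Inst n → K), (∀ J, J ≠ I → sec J = sec' J) →
    ∀ (N : ℕ) (w : List (Obs n t K)), sealedViewProb sec A N I w = sealedViewProb sec' A N I w

end Properties

end

end IVSS

namespace IVSS

open Classical Filter

set_option linter.unusedSectionVars false

noncomputable section

/-! ### Polynomials -/

section Algebra

variable {n t : ℕ} {K : Type} [Field K]

/-! Safety rests on an inductive invariant. `LInv` records, for a single memory, why each entry is
there: the guard that held when the entry was written. This stays meaningful because memories only
grow (`Local.Le`). `GInv` links the processes: packets of uncontrolled senders are justified by the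
senders' memories, and every `ready` for `v` is backed by `n - t` processes that are controlled or
have echoed `v`. Since `n > 3t`, two such supports share an uncontrolled process. This gives
agreement and integrity of A-Cast (`GInv.support_unique`, `GInv.cast_of_support`); together with
fairness it gives totality and validity.

In a candidate set `M`, the "equal" messages force the polynomials of the uncontrolled members to be
pairwise consistent. There are at least `n - 2t > t` of these members, so their polynomials are
slices of one symmetric `F` (`exists_spoly_slice`, `GInv.exists_spoly`). Moreover two correct
processes never form an inferred pair (`GInv.not_infers`), so certification never blocks them, and
with a correct dealer any `n - t` correct processes eventually qualify as a candidate set. What a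
process needs in order to complete is A-Cast, so once one process has completed, the others can
repeat its steps. This is termination.

For correctness, `v = F(0,0)`. Suppose some output comes from an interpolant `f` with `f(0,0) ≠ v`.
Members of the interpolation set have revealed slices of `f`, and correct members reveal slices of
`F`. Full consistency between the two groups would force `f(0,0) = F(0,0)`, so there is a conflict
(`exists_conflict`), and if all of `M` reveals there are many (`card_conflicts`). The process that
produced the output lists the instance in its core set when the round ends, so every correct process
infers the conflicts. The pairs are new (`Run.newPair`): if an earlier `J` was reconstructed, some
correct member `q` of `M` was ready in `J` and listed `J` in its core set, and `q`'s own "checked"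
message certifies that the pair was consistent in `J`.

For secrecy, take a symmetric `D` whose slices vanish at the controlled processes and whose constant
coefficient is the difference of the two secrets. Adding `D` to the dealer's polynomial turns an
execution with one secret into one with the other and the same view (`play_shift`). This acts
injectively on the random choices, so the numbers of favourable choices are equal by symmetry. -/

lemma pt_injective (hK : Set.InjOn (fun m : ℕ => (m : K)) (Set.Iic n)) :
    Function.Injective (pt K : Fin n → K) := by
  intro i j h
  have hi := i.2
  have hj := j.2
  have := hK (x₁ := (i : ℕ) + 1) (x₂ := (j : ℕ) + 1) (by simp) (by simp) h
  exact Fin.ext (by omega)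

lemma pt_ne_zero (hK : Set.InjOn (fun m : ℕ => (m : K)) (Set.Iic n)) (i : Fin n) :
    pt K i ≠ 0 := by
  intro h
  have hi := i.2
  have := hK (x₁ := (i : ℕ) + 1) (x₂ := 0) (by simp) (by simp)
    (by simpa [pt] using h)
  omega

/-- The univariate polynomial with the given coefficients. -/
def UPoly.toPoly (f : UPoly t K) : Polynomial K := ∑ p : Fin (t + 1), Polynomial.monomial p (f p)

lemma UPoly.toPoly_eval (f : UPoly t K) (x : K) : f.toPoly.eval x = f.eval x := by
  simp [toPoly, eval, Polynomial.eval_finsetSum, Polynomial.eval_monomial]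

lemma UPoly.toPoly_coeff (f : UPoly t K) (p : Fin (t + 1)) : f.toPoly.coeff p = f p := by
  simp [toPoly, Polynomial.coeff_monomial, Fin.val_inj]

lemma UPoly.toPoly_degree (f : UPoly t K) : f.toPoly.degree < ((t + 1 : ℕ) : WithBot ℕ) := by
  refine lt_of_le_of_lt (Polynomial.degree_sum_le _ _) ?_
  rw [Finset.sup_lt_iff (by exact WithBot.bot_lt_coe _)]
  intro p _
  exact lt_of_le_of_lt (Polynomial.degree_monomial_le _ _) (by exact_mod_cast p.2)

/-- Polynomials of degree at most `t` that agree at more than `t` points are equal. -/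
lemma UPoly.ext_of_eval {ι : Type*} {v : ι → K} (hv : Function.Injective v) {s : Finset ι}
    (hs : t < s.card) {f g : UPoly t K} (h : ∀ i ∈ s, f.eval (v i) = g.eval (v i)) : f = g := by
  have : f.toPoly = g.toPoly := by
    refine Polynomial.eq_of_degrees_lt_of_eval_index_eq s hv.injOn
      (lt_of_lt_of_le f.toPoly_degree (by exact_mod_cast hs))
      (lt_of_lt_of_le g.toPoly_degree (by exact_mod_cast hs)) ?_
    intro i hi
    rw [toPoly_eval, toPoly_eval, h i hi]
  funext p
  rw [← f.toPoly_coeff, this, g.toPoly_coeff]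

lemma SPoly.slice_eval (a : SPoly t K) (x y : K) : (a.slice x).eval y = a.eval x y := by
  simp only [slice, UPoly.eval, eval, Finset.sum_mul]
  exact Finset.sum_comm

lemma SPoly.eval_comm (a : SPoly t K) (x y : K) : a.eval x y = a.eval y x := by
  unfold eval
  rw [Finset.sum_comm]
  refine Finset.sum_congr rfl fun p _ => Finset.sum_congr rfl fun q _ => ?_
  rw [Sym2.eq_swap]
  ring

lemma SPoly.eval_zero (a : SPoly t K) : a.eval 0 0 = a s(0, 0) := by
  unfold eval
  rw [Finset.sum_eq_single 0, Finset.sum_eq_single 0]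
  · simp
  · intro q _ hq
    rw [zero_pow (Fin.val_ne_zero_iff.2 hq), mul_zero]
  · simp
  · intro q _ hq
    simp [zero_pow (Fin.val_ne_zero_iff.2 hq)]
  · simp

/-- Symmetric polynomials that have more than `t` slices in common have the same constant
coefficient. -/
lemma SPoly.eval_zero_eq_of_slice {ι : Type*} {v : ι → K} (hv : Function.Injective v)
    {s : Finset ι} (hs : t < s.card) {f g : SPoly t K}
    (h : ∀ i ∈ s, f.slice (v i) = g.slice (v i)) : f.eval 0 0 = g.eval 0 0 := by
  -- By symmetry `f(0, v i)` is the value at `0` of the slice at `v i`, so the two slices at `0`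
  -- agree at more than `t` points.
  have : f.slice 0 = g.slice 0 := by
    refine UPoly.ext_of_eval hv hs fun i hi => ?_
    rw [slice_eval, slice_eval, eval_comm, g.eval_comm, ← slice_eval, h i hi, slice_eval]
  rw [← slice_eval, this, slice_eval]

/-- More than `t` univariate polynomials that are pairwise consistent are slices of a symmetric
bivariate polynomial. -/
lemma exists_spoly_slice {ι : Type*} {v : ι → K} (hv : Function.Injective v) {s : Finset ι}
    (hs : t < s.card) (f : ι → UPoly t K)
    (h : ∀ i ∈ s, ∀ j ∈ s, (f i).eval (v j) = (f j).eval (v i)) :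
    ∃ F : SPoly t K, ∀ i ∈ s, F.slice (v i) = f i := by
  -- Exactly `t + 1` nodes are kept, so that the Lagrange basis has degree `t` and fits into `SPoly
  -- t K`.
  obtain ⟨B, hBs, hB⟩ := Finset.exists_subset_card_eq (Nat.succ_le_of_lt hs)
  have hBt : t < B.card := by omega
  let L : ι → Polynomial K := Lagrange.basis B v
  -- Coefficients of the tensor interpolant `∑ f_i(v_j) L_i(x) L_j(y)`; pairwise consistency is what
  -- makes it symmetric.
  let a : Fin (t + 1) → Fin (t + 1) → K := fun p q =>
    ∑ i ∈ B, ∑ j ∈ B, (f i).eval (v j) * (L i).coeff p * (L j).coeff q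
  have ha : ∀ p q, a p q = a q p := by
    intro p q
    show ∑ i ∈ B, ∑ j ∈ B, _ = ∑ i ∈ B, ∑ j ∈ B, _
    rw [Finset.sum_comm]
    refine Finset.sum_congr rfl fun i hi => Finset.sum_congr rfl fun j hj => ?_
    rw [h i (hBs hi) j (hBs hj)]
    ring
  let F : SPoly t K := Sym2.lift ⟨a, ha⟩
  have hLeval : ∀ i ∈ B, ∀ x, ∑ p : Fin (t + 1), (L i).coeff p * x ^ (p : ℕ) = (L i).eval x := by
    intro i hi x
    have hd : (L i).natDegree < t + 1 := by
      have := Lagrange.degree_basis (s := B) (v := v) hv.injOn hi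
      rw [hB] at this
      exact lt_of_le_of_lt (Polynomial.natDegree_le_of_degree_le this.le) (by simp)
    rw [Polynomial.eval_eq_sum_range' hd, Finset.sum_range]
  have hF : ∀ x y, F.eval x y = ∑ i ∈ B, ∑ j ∈ B, (f i).eval (v j) * (L i).eval x * (L j).eval y := by
    intro x y
    have h1 : F.eval x y = ∑ p : Fin (t + 1), ∑ q : Fin (t + 1), ∑ i ∈ B, ∑ j ∈ B,
        (f i).eval (v j) * ((L i).coeff p * x ^ (p : ℕ)) * ((L j).coeff q * y ^ (q : ℕ)) := by
      unfold SPoly.eval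
      refine Finset.sum_congr rfl fun p _ => Finset.sum_congr rfl fun q _ => ?_
      show (∑ i ∈ B, ∑ j ∈ B, _) * _ * _ = _
      simp only [Finset.sum_mul]
      refine Finset.sum_congr rfl fun i _ => Finset.sum_congr rfl fun j _ => ?_
      ring
    rw [h1]
    have h2 : ∀ p : Fin (t + 1), (∑ q : Fin (t + 1), ∑ i ∈ B, ∑ j ∈ B,
        (f i).eval (v j) * ((L i).coeff p * x ^ (p : ℕ)) * ((L j).coeff q * y ^ (q : ℕ))) =
        ∑ i ∈ B, ∑ j ∈ B, (f i).eval (v j) * ((L i).coeff p * x ^ (p : ℕ)) * (L j).eval y := by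
      intro p
      rw [Finset.sum_comm]
      refine Finset.sum_congr rfl fun i _ => ?_
      rw [Finset.sum_comm]
      refine Finset.sum_congr rfl fun j hj => ?_
      rw [← Finset.mul_sum, hLeval j hj]
    simp only [h2]
    rw [Finset.sum_comm]
    refine Finset.sum_congr rfl fun i hi => ?_
    rw [Finset.sum_comm]
    refine Finset.sum_congr rfl fun j _ => ?_
    rw [← Finset.sum_mul, ← Finset.mul_sum, hLeval i hi]
  have hFB : ∀ i ∈ B, ∀ j ∈ B, F.eval (v i) (v j) = (f i).eval (v j) := by
    intro i hi j hj
    rw [hF, Finset.sum_eq_single i, Finset.sum_eq_single j]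
    · show _ * (Lagrange.basis B v i).eval _ * (Lagrange.basis B v j).eval _ = _
      rw [Lagrange.eval_basis_self hv.injOn hi, Lagrange.eval_basis_self hv.injOn hj]
      simp
    · intro k _ hkj
      show _ * _ * (Lagrange.basis B v k).eval _ = _
      rw [Lagrange.eval_basis_of_ne hkj hj, mul_zero]
    · exact fun hc => absurd hj hc
    · intro k _ hki
      refine Finset.sum_eq_zero fun l _ => ?_
      show _ * (Lagrange.basis B v k).eval _ * _ = _
      rw [Lagrange.eval_basis_of_ne hki hi, mul_zero, zero_mul]
    · exact fun hc => absurd hi hc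
  have hsl : ∀ i ∈ B, F.slice (v i) = f i := fun i hi =>
    UPoly.ext_of_eval hv hBt fun j hj => by rw [SPoly.slice_eval, hFB i hi j hj]
  refine ⟨F, fun i hi => UPoly.ext_of_eval hv hBt fun j hj => ?_⟩
  -- A node `i` outside `B` is reached through symmetry: `F(v i, v j)` is a value of the slice at `v
  -- j`, which is already known to be `f j`.
  rw [SPoly.slice_eval, SPoly.eval_comm, ← SPoly.slice_eval, hsl j hj, h i hi j (hBs hj)]

/-- There is a symmetric polynomial with constant coefficient `1` whose slices at at most `t` given
nonzero points vanish. -/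
lemma exists_spoly_vanishing {ι : Type*} {v : ι → K} (hv : ∀ i, v i ≠ 0) {s : Finset ι}
    (hs : s.card ≤ t) :
    ∃ g : SPoly t K, g s(0, 0) = 1 ∧ ∀ i ∈ s, g.slice (v i) = 0 := by
  -- `P` has value `1` at `0`, vanishes at the given points and has degree at most `t`; the witness
  -- is `P(x) P(y)`.
  let P : Polynomial K := ∏ i ∈ s, (1 - Polynomial.C (v i)⁻¹ * Polynomial.X)
  have hP0 : P.coeff 0 = 1 := by
    rw [Polynomial.coeff_zero_eq_eval_zero, Polynomial.eval_prod]
    simp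
  have hPd : P.natDegree < t + 1 := by
    refine Nat.lt_succ_of_le (le_trans (Polynomial.natDegree_prod_le _ _) (le_trans ?_ hs))
    rw [Finset.card_eq_sum_ones]
    refine Finset.sum_le_sum fun i _ => ?_
    compute_degree
  have hPs : ∀ i ∈ s, P.eval (v i) = 0 := by
    intro i hi
    rw [Polynomial.eval_prod]
    exact Finset.prod_eq_zero hi (by simp [hv i])
  refine ⟨Sym2.lift ⟨fun p q => P.coeff p * P.coeff q, fun p q => mul_comm _ _⟩, ?_, ?_⟩
  · simp [hP0]
  · intro i hi
    funext q
    have : ∑ p : Fin (t + 1), P.coeff p * v i ^ (p : ℕ) = 0 := by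
      rw [← hPs i hi, Polynomial.eval_eq_sum_range' hPd, Finset.sum_range]
    calc _ = ∑ p : Fin (t + 1), P.coeff q * (P.coeff p * v i ^ (p : ℕ)) := by
          refine Finset.sum_congr rfl fun p _ => ?_
          simp only [Sym2.lift_mk]
          ring
      _ = 0 := by rw [← Finset.mul_sum, this, mul_zero]

end Algebra

/-! ### The memory of one process -/

section Memory

variable {n t : ℕ} {K : Type} [Field K]

/-- The memory `L'` extends the memory `L`. -/
structure Local.Le (L L' : Local n t K) : Prop where
  round : L.round ≤ L'.round
  rcvd : ∀ x, x ∈ L.rcvd → x ∈ L'.rcvd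
  cast : ∀ g v, L.cast g = some v → L'.cast g = some v
  echoed : ∀ o g v, L.echoed o g = some v → L'.echoed o g = some v
  readied : ∀ o g v, L.readied o g = some v → L'.readied o g = some v
  accepted : ∀ o g v, L.accepted o g = some v → L'.accepted o g = some v
  dealt : ∀ I v, L.dealt I = some v → L'.dealt I = some v
  row : ∀ I v, L.row I = some v → L'.row I = some v
  shared : ∀ I, I ∈ L.shared → I ∈ L'.shared
  doneS : ∀ I, I ∈ L.doneS → I ∈ L'.doneS
  value : ∀ I v, L.value I = some v → L'.value I = some v
  core : ∀ I, I ∈ L.core → I ∈ L'.core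
  output : ∀ I v, L.output I = some v → L'.output I = some v

lemma Local.Le.refl (L : Local n t K) : L.Le L := by
  constructor <;> simp

lemma Local.Le.trans {L L' L'' : Local n t K} (h : L.Le L') (h' : L'.Le L'') : L.Le L'' where
  round := h.round.trans h'.round
  rcvd _ hx := h'.rcvd _ (h.rcvd _ hx)
  cast _ _ hx := h'.cast _ _ (h.cast _ _ hx)
  echoed _ _ _ hx := h'.echoed _ _ _ (h.echoed _ _ _ hx)
  readied _ _ _ hx := h'.readied _ _ _ (h.readied _ _ _ hx)
  accepted _ _ _ hx := h'.accepted _ _ _ (h.accepted _ _ _ hx)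
  dealt _ _ hx := h'.dealt _ _ (h.dealt _ _ hx)
  row _ _ hx := h'.row _ _ (h.row _ _ hx)
  shared _ hx := h'.shared _ (h.shared _ hx)
  doneS _ hx := h'.doneS _ (h.doneS _ hx)
  value _ _ hx := h'.value _ _ (h.value _ _ hx)
  core _ hx := h'.core _ (h.core _ hx)
  output _ _ hx := h'.output _ _ (h.output _ _ hx)

/-- A step of process `k`: from memory `L` to `L'`, sending the packets `ps`. -/
inductive LStep (sec : Inst n → K) (k : Fin n) (L : Local n t K) :
    Local n t K → List (Packet n t K) → Prop where
  | receive (src : Fin n) (m : Msg n t K) : LStep sec k L (L.receive src m) []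
  | call (a : SPoly t K) (c : Call n) (h : c.Guard k L) :
      LStep sec k L (c.run sec a k L).1 (c.run sec a k L).2
  | rule (ρ : Rule n t K) (h : ρ.Guard k L) : LStep sec k L (ρ.run k L).1 (ρ.run k L).2

/-- For every instance reported by `l` in a round before `r`, the process knows the polynomials of `i`
and `j`, and they are consistent. -/
def Local.Certified (L : Local n t K) (r : ℕ) (l i j : Fin n) : Prop :=
  ∀ r' < r, ∃ S, L.accepted l (.core r') = some (.insts S) ∧ ∀ J ∈ S, J.round = r' →
    ∃ M, L.HasCand J M ∧ (i ∈ M → j ∈ M → ∃ fi fj, L.HasPoly J i fi ∧ L.HasPoly J j fj ∧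
      fi.eval (pt K j) = fj.eval (pt K i))

/-- What is known when process `k` has A-Cast `v` under a heading. -/
def Local.CastOK (L : Local n t K) (k : Fin n) : Tag n → Val n t K → Prop
  | .equal J i, v => v = .unit ∧
      ∃ f x, L.row J = some f ∧ (i, .share J x) ∈ L.rcvd ∧ f.eval (pt K i) = x
  | .cand J, v => k = J.dealer ∧ (∃ F, L.dealt J = some F) ∧ ∃ M, v = .procs M ∧ L.GoodCand J M
  | .poly J, v => J ∈ L.doneS ∧ (∃ f, L.row J = some f ∧ v = .poly f) ∧ ∃ M, L.HasCand J M ∧ k ∈ M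
  | .ready J, v => v = .unit ∧ ∃ x, L.value J = some x
  | .core r, v => r < L.round ∧ ∃ S, v = .insts S ∧ ∀ J ∈ S, J.round = r ∧ J ∈ L.core
  | .checked r l e, v => v = .unit ∧ ∃ i j, e = s(i, j) ∧ L.Certified r l i j

/-- What is known when a process has set the value `x` in the reconstruction of `J`. -/
def Local.ValueOK (L : Local n t K) (J : Inst n) (x : K) : Prop :=
  J ∈ L.core ∧ J ∈ L.doneS ∧ L.cast (.ready J) = some .unit ∧
  ∃ (IS : Finset (Fin n)) (f : SPoly t K) (M : Finset (Fin n)), x = f.eval 0 0 ∧ L.HasCand J M ∧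
    IS ⊆ M ∧ IS.card = n - 2 * t ∧
    ∀ i ∈ IS, ∃ fi, L.HasPoly J i fi ∧ ∀ j ∈ M, f.eval (pt K i) (pt K j) = fi.eval (pt K j)

/-- The processes from which the message `m` has been received. -/
def Local.senders (L : Local n t K) (m : Msg n t K) : Finset (Fin n) :=
  Finset.univ.filter fun j => (j, m) ∈ L.rcvd

lemma Local.count_eq (L : Local n t K) (m : Msg n t K) : L.count m = (L.senders m).card := by
  rw [← Set.ncard_coe_finset]
  simp [count, senders]

/-- The processes from which "ready to complete" has been received. -/
def Local.readySet (L : Local n t K) (I : Inst n) : Finset (Fin n) :=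
  Finset.univ.filter fun j => L.accepted j (.ready I) = some .unit

lemma Local.readySet_card (L : Local n t K) (I : Inst n) :
    {j : Fin n | L.accepted j (.ready I) = some .unit}.ncard = (L.readySet I).card := by
  rw [← Set.ncard_coe_finset]
  simp [readySet]

variable {L L' : Local n t K}

lemma Local.Le.senders (h : L.Le L') (m : Msg n t K) : (L.senders m).card ≤ (L'.senders m).card :=
  Finset.card_le_card (Finset.monotone_filter_right _ fun _ _ hj => h.rcvd _ hj)

lemma Local.Le.readySet (h : L.Le L') (I : Inst n) :
    (L.readySet I).card ≤ (L'.readySet I).card :=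
  Finset.card_le_card (Finset.monotone_filter_right _ fun _ _ hj => h.accepted _ _ _ hj)

lemma Local.Le.hasCand (h : L.Le L') {I : Inst n} {M} (hM : L.HasCand I M) : L'.HasCand I M :=
  h.accepted _ _ _ hM

lemma Local.Le.hasPoly (h : L.Le L') {I : Inst n} {i f} (hM : L.HasPoly I i f) :
    L'.HasPoly I i f :=
  h.accepted _ _ _ hM

lemma Local.Le.goodCand (h : L.Le L') {I : Inst n} {M} (hM : L.GoodCand I M) : L'.GoodCand I M :=
  ⟨hM.1, fun i hi j hj => h.accepted _ _ _ (hM.2.1 i hi j hj),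
    fun i hi j hj p hp q hq => h.accepted _ _ _ (hM.2.2 i hi j hj p hp q hq)⟩

lemma Local.Le.certified (h : L.Le L') {r l i j} (hc : L.Certified r l i j) :
    L'.Certified r l i j := by
  intro r' hr'
  obtain ⟨S, hS, hJ⟩ := hc r' hr'
  refine ⟨S, h.accepted _ _ _ hS, fun J hJS hr => ?_⟩
  obtain ⟨M, hM, h1⟩ := hJ J hJS hr
  refine ⟨M, h.hasCand hM, fun hi hj => ?_⟩
  obtain ⟨fi, fj, h2, h3, h4⟩ := h1 hi hj
  exact ⟨fi, fj, h.hasPoly h2, h.hasPoly h3, h4⟩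

lemma Local.Le.castOK (h : L.Le L') {k : Fin n} {g v} (hc : L.CastOK k g v) : L'.CastOK k g v := by
  cases g with
  | equal J i =>
    obtain ⟨h0, f, x, h1, h2, h3⟩ := hc
    exact ⟨h0, f, x, h.row _ _ h1, h.rcvd _ h2, h3⟩
  | cand J =>
    obtain ⟨h0, ⟨F, h1⟩, M, h2, h3⟩ := hc
    exact ⟨h0, ⟨F, h.dealt _ _ h1⟩, M, h2, h.goodCand h3⟩
  | poly J =>
    obtain ⟨h0, ⟨f, h1, h2⟩, M, h3, h4⟩ := hc
    exact ⟨h.doneS _ h0, ⟨f, h.row _ _ h1, h2⟩, M, h.hasCand h3, h4⟩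
  | ready J =>
    obtain ⟨h0, x, h1⟩ := hc
    exact ⟨h0, x, h.value _ _ h1⟩
  | core r =>
    obtain ⟨h0, S, h1, h2⟩ := hc
    exact ⟨h0.trans_le h.round, S, h1, fun J hJ => ⟨(h2 J hJ).1, h.core _ (h2 J hJ).2⟩⟩
  | checked r l e =>
    obtain ⟨h0, i, j, h1, h2⟩ := hc
    exact ⟨h0, i, j, h1, h.certified h2⟩

lemma Local.Le.valueOK (h : L.Le L') {J : Inst n} {x} (hv : L.ValueOK J x) : L'.ValueOK J x := by
  obtain ⟨h1, h2, h3, IS, f, M, h4, h5, h6, h7, h8⟩ := hv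
  refine ⟨h.core _ h1, h.doneS _ h2, h.cast _ _ h3, IS, f, M, h4, h.hasCand h5, h6, h7, ?_⟩
  intro i hi
  obtain ⟨fi, h9, h10⟩ := h8 i hi
  exact ⟨fi, h.hasPoly h9, h10⟩

/-- The invariants of the memory of process `k`. -/
structure LInv (sec : Inst n → K) (k : Fin n) (L : Local n t K) : Prop where
  cast : ∀ g v, L.cast g = some v → L.CastOK k g v
  core_cast : ∀ r < L.round, ∃ S, L.cast (.core r) = some (.insts S)
  echoed : ∀ o g v, L.echoed o g = some v → (o, .acMsg o g v) ∈ L.rcvd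
  readied : ∀ o g v, L.readied o g = some v → n - t ≤ (L.senders (.acEcho o g v)).card ∨
    t + 1 ≤ (L.senders (.acReady o g v)).card
  accepted : ∀ o g v, L.accepted o g = some v → 2 * t + 1 ≤ (L.senders (.acReady o g v)).card
  row : ∀ J f, L.row J = some f → (J.dealer, .row J f) ∈ L.rcvd
  row_ne : ∀ J f, (J.dealer, .row J f) ∈ L.rcvd → L.row J ≠ none
  dealt : ∀ J F, L.dealt J = some F → k = J.dealer ∧ F s(0, 0) = sec J
  shared : ∀ J, J ∈ L.shared → ∃ f, L.row J = some f
  doneS : ∀ J, J ∈ L.doneS → ∃ M, L.HasCand J M ∧ L.GoodCand J M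
  inR : ∀ J, J ∈ L.inR → J ∈ L.doneS
  value : ∀ J x, L.value J = some x → L.ValueOK J x
  value_core : ∀ J x, L.value J = some x → J.round ≤ L.round ∧
    (J.round < L.round → ∃ S, L.cast (.core J.round) = some (.insts S) ∧ J ∈ S)
  core : ∀ J, J ∈ L.core → ∃ x, L.value J = some x
  output : ∀ J x, L.output J = some x → L.value J = some x ∧ n - t ≤ (L.readySet J).card

lemma LInv.start (sec : Inst n → K) (k : Fin n) : LInv sec k (Local.start n t K) := by
  constructor <;> simp [Local.start]

section Fields

variable (L) (src : Fin n) (m : Msg n t K)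

/-- Only `rcvd` and `row` can change on receipt. Rewriting with this makes every other field
definitionally the old one. -/
lemma Local.receive_eq : L.receive src m =
    { L with rcvd := insert (src, m) L.rcvd, row := (L.receive src m).row } := by
  unfold receive
  cases m <;> simp
  split_ifs <;> rfl

lemma Local.receive_rcvd : (L.receive src m).rcvd = insert (src, m) L.rcvd := by
  rw [receive_eq]

lemma Local.receive_row (J : Inst n) (f : UPoly t K) : (L.receive src m).row J = some f ↔
    L.row J = some f ∨ (L.row J = none ∧ src = J.dealer ∧ m = .row J f) := by
  unfold receive
  cases m <;> simp
  case row I f' =>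
    by_cases hJ : J = I
    · subst hJ
      by_cases hs : src = J.dealer <;> cases h : L.row J <;> simp [hs, h]
    · split_ifs <;> simp [hJ, Ne.symm hJ]

end Fields

/-- An inconsistency between the two polynomials in an instance reported by `l` would already have
put the pair into `FP`, which the guard excludes. -/
lemma Certified_of_guard {k : Fin n} {r : ℕ} {l i j : Fin n}
    (h : (Rule.certify r l i j : Rule n t K).Guard k L) : L.Certified r l i j := by
  obtain ⟨-, h1, h2, h3⟩ := h
  intro r' hr'
  obtain ⟨S, hS⟩ := h1 r' hr'
  refine ⟨S, hS, fun J hJ hJr => ?_⟩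
  subst hJr
  obtain ⟨M, hM, hi, hj⟩ := h2 J hr' ⟨S, hS, hJ⟩
  refine ⟨M, hM, fun hiM hjM => ?_⟩
  obtain ⟨fi, hfi⟩ := hi hiM
  obtain ⟨fj, hfj⟩ := hj hjM
  refine ⟨fi, fj, hfi, hfj, ?_⟩
  by_contra hne
  exact h3 ⟨J, ⟨l, S, hS, hJ⟩, M, hM, i, hiM, j, hjM, fi, fj, rfl, hfi, hfj, hne⟩

variable {sec : Inst n → K} {k : Fin n} {ps : List (Packet n t K)}

/-- Entries that a step writes were empty before, or already held the value being written. The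
participation sets `inS` and `inR` can shrink and are therefore not part of `Local.Le`. -/
lemma LStep.le (hL : LInv sec k L) (h : LStep sec k L L' ps) : L.Le L' := by
  cases h with
  | receive src m =>
    rw [Local.receive_eq]
    constructor <;> simp +contextual [Local.receive_row]
  | call a c hc =>
    -- A core set is only ever A-Cast for a round that is over, so `nextRound` overwrites nothing.
    have hcast : L.cast (.core L.round) = none := by
      by_contra hne
      obtain ⟨v, hv⟩ := Option.ne_none_iff_exists'.1 hne
      exact lt_irrefl _ (hL.cast _ _ hv).1
    cases c <;> simp only [Call.Guard] at hc <;> constructor <;>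
      simp +contextual [Call.run, Local.acast, Function.update_apply] <;> grind
  | rule ρ hρ =>
    cases ρ
    case share I =>
      obtain ⟨f, hf⟩ := Option.ne_none_iff_exists'.1 hρ.2.2
      constructor <;> simp +contextual [Rule.run, hf]
    case reveal I =>
      obtain ⟨f, hf⟩ := Option.ne_none_iff_exists'.1 hρ.2.2.2.1
      have := hρ.2.2.1
      constructor <;> simp +contextual [Rule.run, hf, Local.acast, Function.update_apply] <;> grind
    case interpolate I IS f =>
      have hv := hρ.2.1
      -- The guard does not mention the heading `ready`, but an earlier entry there could only be
      -- `unit`, so overwriting is harmless.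
      have hc : ∀ v, L.cast (.ready I) = some v → v = .unit := fun v hv => (hL.cast _ _ hv).1
      constructor <;> simp +contextual [Rule.run, Local.acast, Function.update_apply] <;> grind
    all_goals
      simp only [Rule.Guard] at hρ
      constructor <;>
      simp +contextual [Rule.run, Local.acast, Function.update_apply] <;> grind

end Memory

/-! ### Preservation of the local invariants by the steps of a process. -/

section Invariant

variable {n t : ℕ} {K : Type} [Field K] {L L' : Local n t K}
  {sec : Inst n → K} {k : Fin n} {ps : List (Packet n t K)}

/-- For a new A-Cast the guard usually supplies the claim in the old memory, and monotonicity
carries it over. For `nextRound` and `interpolate` it holds only in the new memory, since the round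
or the value changes in the same step. -/
lemma LStep.cast_ok (hL : LInv sec k L) (h : LStep sec k L L' ps) (g : Tag n) (v : Val n t K)
    (hv : L'.cast g = some v) : L'.CastOK k g v := by
  have hle := h.le hL
  by_cases hold : L.cast g = some v
  · exact hle.castOK (hL.cast g v hold)
  cases h with
  | receive src m =>
    rw [Local.receive_eq] at hv
    exact absurd hv hold
  | call a c hc =>
    cases c
    case nextRound =>
      simp only [Call.run, Local.acast, Function.update_apply] at hv
      split_ifs at hv with hg
      · subst hg
        cases hv
        refine ⟨Nat.lt_succ_self _, _, rfl, fun J hJ => ?_⟩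
        simpa [Call.run, Local.acast, and_comm] using hJ
      · exact absurd hv hold
    all_goals exact absurd hv hold
  | rule ρ hρ =>
    cases ρ
    case share I =>
      obtain ⟨f, hf⟩ := Option.ne_none_iff_exists'.1 hρ.2.2
      simp only [Rule.run, hf] at hv
      exact absurd hv hold
    case reveal I =>
      obtain ⟨-, h1, -, h2, h3⟩ := hρ
      obtain ⟨f, hf⟩ := Option.ne_none_iff_exists'.1 h2
      simp only [Rule.run, hf, Local.acast, Function.update_apply] at hv
      split_ifs at hv with hg
      · subst hg
        cases hv
        refine hle.castOK (L := L) ⟨h1, ⟨f, hf, rfl⟩, h3⟩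
      · exact absurd hv hold
    case equal I i =>
      simp only [Rule.run, Local.acast, Function.update_apply] at hv
      split_ifs at hv with hg
      · subst hg
        cases hv
        exact hle.castOK (L := L) ⟨rfl, hρ.2.2⟩
      · exact absurd hv hold
    case candidate I M =>
      simp only [Rule.run, Local.acast, Function.update_apply] at hv
      split_ifs at hv with hg
      · subst hg
        cases hv
        exact hle.castOK (L := L)
          ⟨hρ.2.2.1, Option.ne_none_iff_exists'.1 hρ.2.2.2.1, M, rfl, hρ.2.2.2.2⟩
      · exact absurd hv hold
    case interpolate I IS f =>
      simp only [Rule.run, Local.acast, Function.update_apply] at hv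
      split_ifs at hv with hg
      · subst hg
        cases hv
        exact ⟨rfl, f.eval 0 0, by simp [Rule.run, Local.acast]⟩
      · exact absurd hv hold
    case certify r l i j =>
      simp only [Rule.run, Local.acast, Function.update_apply] at hv
      split_ifs at hv with hg
      · subst hg
        cases hv
        exact hle.castOK (L := L) ⟨rfl, i, j, rfl, Certified_of_guard hρ⟩
      · exact absurd hv hold
    all_goals exact absurd hv hold

/-- Old entries keep their justification by monotonicity; a new entry is written by one kind of
step, and what that step checks or writes is the justification. The field that needs rounds is
`value_core`: values are set only in the round of the instance, so the set A-Cast at the end of that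
round contains the instance. -/
lemma LStep.inv (hL : LInv sec k L) (h : LStep sec k L L' ps) : LInv sec k L' := by
  have hle := h.le hL
  have hcast := h.cast_ok hL
  constructor
  case cast => exact hcast
  case core_cast =>
    intro r hr
    by_cases hold : r < L.round
    · obtain ⟨S, hS⟩ := hL.core_cast r hold
      exact ⟨S, hle.cast _ _ hS⟩
    cases h with
    | receive src m => rw [Local.receive_eq] at hr; exact absurd hr hold
    | call a c hc =>
      cases c
      case nextRound =>
        have : r = L.round := by simp [Call.run, Local.acast] at hr; omega
        subst this
        simp [Call.run, Local.acast]
      all_goals exact absurd hr hold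
    | rule ρ hρ =>
      have : (ρ.run k L).1.round = L.round := by
        cases ρ <;> simp only [Rule.run, Local.acast] <;> split <;> rfl
      omega
  case echoed =>
    intro o g v hv
    by_cases hold : L.echoed o g = some v
    · exact hle.rcvd _ (hL.echoed o g v hold)
    cases h with
    | receive src m => rw [Local.receive_eq] at hv; exact absurd hv hold
    | call a c hc => cases c <;> exact absurd hv hold
    | rule ρ hρ =>
      cases ρ
      case echo o' g' v' =>
        simp only [Rule.run, Function.update_apply] at hv
        have := hρ.2
        simp only [Rule.run]
        grind
      all_goals simp only [Rule.run, Local.acast] at hv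
      case share | reveal => split at hv <;> exact absurd hv hold
      all_goals exact absurd hv hold
  case readied =>
    intro o g v hv
    by_cases hold : L.readied o g = some v
    · exact (hL.readied o g v hold).imp (fun h => h.trans (hle.senders _))
        (fun h => h.trans (hle.senders _))
    cases h with
    | receive src m => rw [Local.receive_eq] at hv; exact absurd hv hold
    | call a c hc => cases c <;> exact absurd hv hold
    | rule ρ hρ =>
      cases ρ
      case ready o' g' v' =>
        simp only [Rule.run, Function.update_apply] at hv
        have := hρ.2
        simp only [Local.count_eq] at this
        simp only [Rule.run]
        have h1 := hle.senders (.acEcho o g v)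
        have h2 := hle.senders (.acReady o g v)
        simp only [Rule.run] at h1 h2
        grind
      all_goals simp only [Rule.run, Local.acast] at hv
      case share | reveal => split at hv <;> exact absurd hv hold
      all_goals exact absurd hv hold
  case accepted =>
    intro o g v hv
    by_cases hold : L.accepted o g = some v
    · exact (hL.accepted o g v hold).trans (hle.senders _)
    cases h with
    | receive src m => rw [Local.receive_eq] at hv; exact absurd hv hold
    | call a c hc => cases c <;> exact absurd hv hold
    | rule ρ hρ =>
      cases ρ
      case accept o' g' v' =>
        simp only [Rule.run, Function.update_apply] at hv
        have := hρ.2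
        simp only [Local.count_eq] at this
        simp only [Rule.run]
        have h2 := hle.senders (.acReady o g v)
        simp only [Rule.run] at h2
        grind
      all_goals simp only [Rule.run, Local.acast] at hv
      case share | reveal => split at hv <;> exact absurd hv hold
      all_goals exact absurd hv hold
  case row =>
    intro J f hv
    by_cases hold : L.row J = some f
    · exact hle.rcvd _ (hL.row J f hold)
    cases h with
    | receive src m =>
      rw [Local.receive_row] at hv
      rw [Local.receive_rcvd]
      grind
    | call a c hc => cases c <;> exact absurd hv hold
    | rule ρ hρ =>
      cases ρ
      all_goals simp only [Rule.run, Local.acast] at hv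
      case share | reveal => split at hv <;> exact absurd hv hold
      all_goals exact absurd hv hold
  case row_ne =>
    intro J f hv
    by_cases hold : (J.dealer, .row J f) ∈ L.rcvd
    · obtain ⟨f', hf'⟩ := Option.ne_none_iff_exists'.1 (hL.row_ne J f hold)
      rw [hle.row _ _ hf']
      simp
    cases h with
    | receive src m =>
      rw [Local.receive_rcvd] at hv
      cases hr : L.row J with
      | some f' => rw [hle.row _ _ hr]; simp
      | none =>
        rw [(Local.receive_row L src m J f).2 (Or.inr ⟨hr, by grind⟩)]
        simp
    | call a c hc => cases c <;> exact absurd hv hold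
    | rule ρ hρ =>
      cases ρ
      all_goals simp only [Rule.run, Local.acast] at hv
      case share | reveal => split at hv <;> exact absurd hv hold
      all_goals exact absurd hv hold
  case dealt =>
    intro J F hv
    by_cases hold : L.dealt J = some F
    · exact hL.dealt J F hold
    cases h with
    | receive src m => rw [Local.receive_eq] at hv; exact absurd hv hold
    | call a c hc =>
      cases c
      case deal I =>
        simp only [Call.run, Function.update_apply] at hv
        split_ifs at hv with hJ
        · subst hJ
          cases hv
          exact ⟨hc.1, by simp [SPoly.withSecret]⟩
        · exact absurd hv hold
      all_goals exact absurd hv hold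
    | rule ρ hρ =>
      cases ρ
      all_goals simp only [Rule.run, Local.acast] at hv
      case share | reveal => split at hv <;> exact absurd hv hold
      all_goals exact absurd hv hold
  case shared =>
    intro J hv
    by_cases hold : J ∈ L.shared
    · obtain ⟨f, hf⟩ := hL.shared J hold
      exact ⟨f, hle.row _ _ hf⟩
    cases h with
    | receive src m => rw [Local.receive_eq] at hv; exact absurd hv hold
    | call a c hc => cases c <;> exact absurd hv hold
    | rule ρ hρ =>
      cases ρ
      case share I =>
        obtain ⟨f, hf⟩ := Option.ne_none_iff_exists'.1 hρ.2.2
        simp only [Rule.run, hf] at hv ⊢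
        simp only [Set.mem_insert_iff, hold, or_false] at hv
        subst hv
        exact ⟨f, hf⟩
      all_goals simp only [Rule.run, Local.acast] at hv
      case reveal => split at hv <;> exact absurd hv hold
      all_goals exact absurd hv hold
  case doneS =>
    intro J hv
    by_cases hold : J ∈ L.doneS
    · obtain ⟨M, h1, h2⟩ := hL.doneS J hold
      exact ⟨M, hle.hasCand h1, hle.goodCand h2⟩
    cases h with
    | receive src m => rw [Local.receive_eq] at hv; exact absurd hv hold
    | call a c hc => cases c <;> exact absurd hv hold
    | rule ρ hρ =>
      cases ρ
      case completeS I =>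
        simp only [Rule.run, Set.mem_insert_iff, hold, or_false] at hv
        subst hv
        exact hρ.2.2
      all_goals simp only [Rule.run, Local.acast] at hv
      case share | reveal => split at hv <;> exact absurd hv hold
      all_goals exact absurd hv hold
  case inR =>
    intro J hv
    by_cases hold : J ∈ L.inR
    · exact hle.doneS _ (hL.inR J hold)
    cases h with
    | receive src m => rw [Local.receive_eq] at hv; exact absurd hv hold
    | call a c hc =>
      cases c
      case joinR I =>
        simp only [Call.run, Set.mem_insert_iff, hold, or_false] at hv
        subst hv
        exact hc.2.2
      case leaveR I => exact absurd hv.1 hold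
      all_goals exact absurd hv hold
    | rule ρ hρ =>
      cases ρ
      all_goals simp only [Rule.run, Local.acast] at hv
      case share | reveal => split at hv <;> exact absurd hv hold
      all_goals exact absurd hv hold
  case value =>
    intro J x hv
    by_cases hold : L.value J = some x
    · exact hle.valueOK (hL.value J x hold)
    cases h with
    | receive src m => rw [Local.receive_eq] at hv; exact absurd hv hold
    | call a c hc => cases c <;> exact absurd hv hold
    | rule ρ hρ =>
      cases ρ
      case interpolate I IS f =>
        have hv' := hv
        simp only [Rule.run, Local.acast, Function.update_apply] at hv
        split_ifs at hv with hJ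
        · subst hJ
          cases hv
          obtain ⟨h1, h2, M, h3, h4, h5, h6⟩ := hρ
          refine ⟨by simp [Rule.run, Local.acast], hle.doneS _ (hL.inR _ h1.1),
            by simp [Rule.run, Local.acast], IS, f, M, rfl, hle.hasCand h3, h4, h5, ?_⟩
          intro i hi
          obtain ⟨fi, h7, h8⟩ := h6 i hi
          exact ⟨fi, hle.hasPoly h7, h8⟩
        · exact absurd hv hold
      all_goals simp only [Rule.run, Local.acast] at hv
      case share | reveal => split at hv <;> exact absurd hv hold
      all_goals exact absurd hv hold
  case value_core =>
    intro J x hv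
    by_cases hold : L.value J = some x
    · obtain ⟨h1, h2⟩ := hL.value_core J x hold
      refine ⟨h1.trans hle.round, fun hr => ?_⟩
      rcases h1.lt_or_eq with h1 | h1
      · obtain ⟨S, hS, hJ⟩ := h2 h1
        exact ⟨S, hle.cast _ _ hS, hJ⟩
      -- The round of `J` is the current one, so only `nextRound` can end it, and that call A-Casts
      -- the part of `core` belonging to this round, which contains `J`.
      · cases h with
        | receive src m => rw [Local.receive_eq] at hr; exact absurd hr h1.not_lt
        | call a c hc =>
          cases c
          case nextRound =>
            have hJ := (hL.value J x hold).1
            simp [Call.run, Local.acast, h1, hJ]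
          all_goals exact absurd hr h1.not_lt
        | rule ρ hρ =>
          have : (ρ.run k L).1.round = L.round := by
            cases ρ <;> simp only [Rule.run, Local.acast] <;> split <;> rfl
          omega
    cases h with
    | receive src m => rw [Local.receive_eq] at hv; exact absurd hv hold
    | call a c hc => cases c <;> exact absurd hv hold
    | rule ρ hρ =>
      cases ρ
      case interpolate I IS f =>
        simp only [Rule.run, Local.acast, Function.update_apply] at hv
        split_ifs at hv with hJ
        · subst hJ
          have h1 := hρ.1.2
          simp [Rule.run, Local.acast, h1]
        · exact absurd hv hold
      all_goals simp only [Rule.run, Local.acast] at hv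
      case share | reveal => split at hv <;> exact absurd hv hold
      all_goals exact absurd hv hold
  case core =>
    intro J hv
    by_cases hold : J ∈ L.core
    · obtain ⟨f, hf⟩ := hL.core J hold
      exact ⟨f, hle.value _ _ hf⟩
    cases h with
    | receive src m => rw [Local.receive_eq] at hv; exact absurd hv hold
    | call a c hc => cases c <;> exact absurd hv hold
    | rule ρ hρ =>
      cases ρ
      case interpolate I IS f =>
        simp only [Rule.run, Local.acast, Finset.mem_insert, hold, or_false] at hv
        subst hv
        simp [Rule.run, Local.acast]
      all_goals simp only [Rule.run, Local.acast] at hv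
      case share | reveal => split at hv <;> exact absurd hv hold
      all_goals exact absurd hv hold
  case output =>
    intro J x hv
    by_cases hold : L.output J = some x
    · obtain ⟨h1, h2⟩ := hL.output J x hold
      exact ⟨hle.value _ _ h1, h2.trans (hle.readySet _)⟩
    cases h with
    | receive src m => rw [Local.receive_eq] at hv; exact absurd hv hold
    | call a c hc => cases c <;> exact absurd hv hold
    | rule ρ hρ =>
      cases ρ
      case finish I =>
        simp only [Rule.run, Function.update_apply] at hv
        split_ifs at hv with hJ
        · subst hJ
          refine ⟨hv, ?_⟩
          have := hρ.2.2.2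
          rw [Local.readySet_card] at this
          exact this
        · exact absurd hv hold
      all_goals simp only [Rule.run, Local.acast] at hv
      case share | reveal => split at hv <;> exact absurd hv hold
      all_goals exact absurd hv hold

end Invariant

/-! ### Invariants of the whole system -/

section System

variable {n t : ℕ} {K : Type} [Field K] {sec : Inst n → K}

/-- The memory `L` of process `k` witnesses that `k` has sent the message `m` to `j`. -/
def Local.Sent (L : Local n t K) (k j : Fin n) : Msg n t K → Prop
  | .row J f => k = J.dealer ∧ ∃ F, L.dealt J = some F ∧ f = F.slice (pt K j)
  | .share J x => ∃ f, L.row J = some f ∧ x = f.eval (pt K j)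
  | .acMsg o g v => o = k ∧ L.cast g = some v
  | .acEcho o g v => L.echoed o g = some v
  | .acReady o g v => L.readied o g = some v

lemma Local.Le.sent {L L' : Local n t K} (h : L.Le L') {k j : Fin n} {m : Msg n t K}
    (hs : L.Sent k j m) : L'.Sent k j m := by
  cases m with
  | row J f =>
    obtain ⟨h0, F, h1, h2⟩ := hs
    exact ⟨h0, F, h.dealt _ _ h1, h2⟩
  | share J x =>
    obtain ⟨f, h1, h2⟩ := hs
    exact ⟨f, h.row _ _ h1, h2⟩
  | acMsg o g v => exact ⟨hs.1, h.cast _ _ hs.2⟩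
  | acEcho o g v => exact h.echoed _ _ _ hs
  | acReady o g v => exact h.readied _ _ _ hs

/-- Everything that the memory `L` of process `k` records as sent is in the network. -/
def Local.Out (L : Local n t K) (k : Fin n) (net : List (Packet n t K)) : Prop :=
  ∀ j, (∀ J F, L.dealt J = some F → ⟨k, j, .row J (F.slice (pt K j))⟩ ∈ net) ∧
    (∀ J f, J ∈ L.shared → L.row J = some f → ⟨k, j, .share J (f.eval (pt K j))⟩ ∈ net) ∧
    (∀ g v, L.cast g = some v → ⟨k, j, .acMsg k g v⟩ ∈ net) ∧
    (∀ o g v, L.echoed o g = some v → ⟨k, j, .acEcho o g v⟩ ∈ net) ∧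
    (∀ o g v, L.readied o g = some v → ⟨k, j, .acReady o g v⟩ ∈ net)

lemma mem_toAll {k i j : Fin n} {m m' : Msg n t K} :
    ⟨i, j, m'⟩ ∈ toAll k m ↔ i = k ∧ m' = m := by
  simp [toAll, eq_comm]

variable {k : Fin n} {L L' : Local n t K} {ps : List (Packet n t K)}

lemma LStep.sent (h : LStep sec k L L' ps) :
    ∀ p ∈ ps, p.src = k ∧ L'.Sent k p.dst p.msg := by
  rintro ⟨src, dst, m⟩ hp
  cases h with
  | receive src m => simp at hp
  | call a c hc =>
    cases c
    case nextRound =>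
      obtain ⟨rfl, rfl⟩ := mem_toAll.1 hp
      simp [Call.run, Local.acast, Local.Sent]
    case deal I =>
      simp only [Call.run, List.mem_map, List.mem_finRange, true_and, Packet.mk.injEq] at hp
      obtain ⟨i, rfl, rfl, rfl⟩ := hp
      exact ⟨rfl, hc.1, a.withSecret (sec I), by simp [Call.run], rfl⟩
    all_goals simp [Call.run] at hp
  | rule ρ hρ =>
    cases ρ
    case share I =>
      obtain ⟨f, hf⟩ := Option.ne_none_iff_exists'.1 hρ.2.2
      simp only [Rule.run, hf, List.mem_map, List.mem_finRange, true_and, Packet.mk.injEq] at hp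
      obtain ⟨i, rfl, rfl, rfl⟩ := hp
      exact ⟨rfl, f, by simp [Rule.run, hf], rfl⟩
    case reveal I =>
      obtain ⟨f, hf⟩ := Option.ne_none_iff_exists'.1 hρ.2.2.2.1
      simp only [Rule.run, hf, Local.acast] at hp
      obtain ⟨rfl, rfl⟩ := mem_toAll.1 hp
      simp [Rule.run, Local.acast, Local.Sent, hf]
    all_goals
      simp only [Rule.run, Local.acast] at hp
    case accept | completeS | finish => simp at hp
    all_goals
      obtain ⟨rfl, rfl⟩ := mem_toAll.1 hp
      simp [Rule.run, Local.acast, Local.Sent]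

/-- Converse to `LStep.sent`: what the memory records as sent really is in the network. For shares
this uses that a stored row never changes after it has been sent out. -/
lemma LStep.out (hL : LInv sec k L) (h : LStep sec k L L' ps) {net : List (Packet n t K)}
    (ho : L.Out k net) : L'.Out k (net ++ ps) := by
  intro j
  obtain ⟨h1, h2, h3, h4, h5⟩ := ho j
  cases h with
  | receive src m =>
    simp only [List.append_nil]
    refine ⟨?_, ?_, ?_, ?_, ?_⟩
    · rw [Local.receive_eq]; exact h1
    · intro J f hJ hf
      rw [Local.receive_eq] at hJ
      obtain ⟨f', hf'⟩ := hL.shared J hJ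
      have hle := (LStep.receive (sec := sec) (k := k) src m).le hL
      have := hle.row _ _ hf'
      rw [hf] at this
      cases this
      exact h2 J f hJ hf'
    · rw [Local.receive_eq]; exact h3
    · rw [Local.receive_eq]; exact h4
    · rw [Local.receive_eq]; exact h5
  | call a c hc =>
    cases c
    case deal I =>
      refine ⟨?_, ?_, ?_, ?_, ?_⟩
      · intro J F hF
        simp only [Call.run, Function.update_apply] at hF
        split_ifs at hF with hJ
        · subst hJ
          cases hF
          simp [Call.run]
        · exact List.mem_append_left _ (h1 J F hF)
      · exact fun J f hJ hf => List.mem_append_left _ (h2 J f hJ hf)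
      · exact fun g v hv => List.mem_append_left _ (h3 g v hv)
      · exact fun o g v hv => List.mem_append_left _ (h4 o g v hv)
      · exact fun o g v hv => List.mem_append_left _ (h5 o g v hv)
    all_goals
      simp only [Call.run, Local.acast, List.append_nil, List.mem_append, mem_toAll]
      refine ⟨?_, ?_, ?_, ?_, ?_⟩
      · grind
      · grind
      · try simp only [Function.update_apply]
        grind
      · grind
      · grind
  | rule ρ hρ =>
    cases ρ
    case share I =>
      obtain ⟨f, hf⟩ := Option.ne_none_iff_exists'.1 hρ.2.2
      simp only [Rule.run, hf]
      refine ⟨?_, ?_, ?_, ?_, ?_⟩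
      · exact fun J f hJ => List.mem_append_left _ (h1 J f hJ)
      · intro J f' hJ hf'
        rcases hJ with rfl | hJ
        · rw [hf] at hf'
          cases hf'
          simp
        · exact List.mem_append_left _ (h2 J f' hJ hf')
      · exact fun g v hv => List.mem_append_left _ (h3 g v hv)
      · exact fun o g v hv => List.mem_append_left _ (h4 o g v hv)
      · exact fun o g v hv => List.mem_append_left _ (h5 o g v hv)
    case reveal I =>
      obtain ⟨f, hf⟩ := Option.ne_none_iff_exists'.1 hρ.2.2.2.1
      simp only [Rule.run, hf, Local.acast, List.mem_append, mem_toAll,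
        Function.update_apply]
      refine ⟨?_, ?_, ?_, ?_, ?_⟩ <;> grind
    all_goals
      simp only [Rule.run, Local.acast, List.append_nil, List.mem_append, mem_toAll,
        Function.update_apply]
      refine ⟨?_, ?_, ?_, ?_, ?_⟩ <;> grind

/-- The quorum is counted in the memory before the step, so the support invariant of the old state
can be applied to its senders. -/
lemma LStep.readied_new (h : LStep sec k L L' ps) {o g v} (hv : L'.readied o g = some v) :
    L.readied o g = some v ∨ n - t ≤ (L.senders (.acEcho o g v)).card ∨
      t + 1 ≤ (L.senders (.acReady o g v)).card := by
  by_cases hold : L.readied o g = some v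
  · exact Or.inl hold
  right
  cases h with
  | receive src m => rw [Local.receive_eq] at hv; exact absurd hv hold
  | call a c hc => cases c <;> exact absurd hv hold
  | rule ρ hρ =>
    cases ρ
    case ready o' g' v' =>
      simp only [Rule.run, Function.update_apply] at hv
      have := hρ.2
      simp only [Local.count_eq] at this
      grind
    all_goals simp only [Rule.run, Local.acast] at hv
    case share | reveal => split at hv <;> exact absurd hv hold
    all_goals exact absurd hv hold

lemma Call.run_rcvd (a : SPoly t K) (c : Call n) : (c.run sec a k L).1.rcvd = L.rcvd := by
  cases c <;> rfl

lemma Rule.run_rcvd (ρ : Rule n t K) : (ρ.run k L).1.rcvd = L.rcvd := by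
  cases ρ <;> simp only [Rule.run, Local.acast] <;> split <;> rfl

/-- The state `σ'` extends the state `σ`. -/
structure State.Le (σ σ' : State n t K) : Prop where
  corrupted : σ.corrupted ⊆ σ'.corrupted
  net : ∃ l, σ'.net = σ.net ++ l
  loc : ∀ k, (σ.loc k).Le (σ'.loc k)

lemma State.Le.refl (σ : State n t K) : σ.Le σ :=
  ⟨subset_rfl, ⟨[], by simp⟩, fun _ => .refl _⟩

lemma State.Le.trans {σ σ' σ'' : State n t K} (h : σ.Le σ') (h' : σ'.Le σ'') : σ.Le σ'' := by
  refine ⟨h.corrupted.trans h'.corrupted, ?_, fun k => (h.loc k).trans (h'.loc k)⟩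
  obtain ⟨l, hl⟩ := h.net
  obtain ⟨l', hl'⟩ := h'.net
  exact ⟨l ++ l', by rw [hl', hl, List.append_assoc]⟩

/-- The processes that are controlled or have sent `echo` for `v`. -/
def State.support (σ : State n t K) (o : Fin n) (g : Tag n) (v : Val n t K) : Finset (Fin n) :=
  Finset.univ.filter fun j => j ∈ σ.corrupted ∨ (σ.loc j).echoed o g = some v

lemma State.Le.support {σ σ' : State n t K} (h : σ.Le σ') (o : Fin n) (g : Tag n)
    (v : Val n t K) : (σ.support o g v).card ≤ (σ'.support o g v).card :=
  Finset.card_le_card (Finset.monotone_filter_right _ fun _ _ hj =>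
    hj.imp (fun x => h.corrupted x) (fun x => (h.loc _).echoed _ _ _ x))

/-- The invariants of reachable states. -/
structure GInv (sec : Inst n → K) (σ : State n t K) : Prop where
  loc : ∀ k, LInv sec k (σ.loc k)
  out : ∀ k, (σ.loc k).Out k σ.net
  sound : ∀ p ∈ σ.net, p.src ∉ σ.corrupted → (σ.loc p.src).Sent p.src p.dst p.msg
  rcvd : ∀ k j m, (j, m) ∈ (σ.loc k).rcvd → ⟨j, k, m⟩ ∈ σ.net
  card : σ.corrupted.card ≤ t
  supp : ∀ k o g v, (σ.loc k).readied o g = some v → n - t ≤ (σ.support o g v).card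

lemma GInv.start (sec : Inst n → K) : GInv sec (State.start n t K) where
  loc k := LInv.start sec k
  out k j := by simp [State.start, Local.start]
  sound := by simp [State.start]
  rcvd := by simp [State.start, Local.start]
  card := by simp [State.start]
  supp := by simp [State.start, Local.start]

variable {σ : State n t K}

lemma GInv.senders_sent (h : GInv sec σ) {k j : Fin n} {m : Msg n t K}
    (hj : j ∈ (σ.loc k).senders m) : j ∈ σ.corrupted ∨ (σ.loc j).Sent j k m := by
  by_cases hc : j ∈ σ.corrupted
  · exact Or.inl hc
  · exact Or.inr (h.sound _ (h.rcvd k j m (by simpa [Local.senders] using hj)) hc)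

/-- Among more than `t` processes there is one that is not controlled. -/
lemma GInv.exists_uncorrupted (h : GInv sec σ) {s : Finset (Fin n)} (hs : t < s.card) :
    ∃ j ∈ s, j ∉ σ.corrupted := by
  by_contra! hc
  exact absurd (Finset.card_le_card (fun j hj => hc j hj : s ⊆ σ.corrupted))
    (by have := h.card; omega)

/-- A quorum of `echo` is itself a support. Among `t + 1` senders of `ready` one is uncontrolled,
and its own `ready` was already supported by echoes. -/
lemma GInv.support_of_quorum (h : GInv sec σ) {k : Fin n} {o g v}
    (hq : n - t ≤ ((σ.loc k).senders (.acEcho o g v)).card ∨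
      t + 1 ≤ ((σ.loc k).senders (.acReady o g v)).card) :
    n - t ≤ (σ.support o g v).card := by
  rcases hq with hq | hq
  · refine hq.trans (Finset.card_le_card fun j hj => ?_)
    simp only [State.support, Finset.mem_filter, Finset.mem_univ, true_and]
    exact h.senders_sent hj
  · obtain ⟨j, hj, hc⟩ := h.exists_uncorrupted hq
    exact h.supp j o g v ((h.senders_sent hj).resolve_left hc)

lemma State.le_local (h : GInv sec σ) (hs : LStep sec k (σ.loc k) L' ps) :
    σ.Le (σ.local k (L', ps)) := by
  refine ⟨subset_rfl, ⟨ps, rfl⟩, fun j => ?_⟩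
  by_cases hj : j = k
  · subst hj
    simpa [State.local] using hs.le (h.loc j)
  · simpa [State.local, hj] using Local.Le.refl _

lemma GInv.local (h : GInv sec σ) (hs : LStep sec k (σ.loc k) L' ps)
    (hr : ∀ j m, (j, m) ∈ L'.rcvd → ⟨j, k, m⟩ ∈ σ.net) : GInv sec (σ.local k (L', ps)) := by
  have hle := State.le_local h hs
  refine ⟨fun j => ?_, fun j => ?_, fun p hp hc => ?_, fun j i m hm => ?_, h.card,
    fun j o g v hv => ?_⟩
  · by_cases hj : j = k
    · subst hj
      simpa [State.local] using hs.inv (h.loc j)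
    · simpa [State.local, hj] using h.loc j
  · by_cases hj : j = k
    · subst hj
      simpa [State.local] using hs.out (h.loc j) (h.out j)
    · have := h.out j
      simp only [State.local, Function.update_of_ne hj]
      intro i
      obtain ⟨h1, h2, h3, h4, h5⟩ := this i
      exact ⟨fun J f hJ => List.mem_append_left _ (h1 J f hJ),
        fun J f hJ hf => List.mem_append_left _ (h2 J f hJ hf),
        fun g v hv => List.mem_append_left _ (h3 g v hv),
        fun o g v hv => List.mem_append_left _ (h4 o g v hv),
        fun o g v hv => List.mem_append_left _ (h5 o g v hv)⟩
  · rcases List.mem_append.1 hp with hp | hp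
    · exact (hle.loc _).sent (h.sound p hp hc)
    · obtain ⟨h1, h2⟩ := hs.sent p hp
      simpa [State.local, h1] using h2
  · refine List.mem_append_left _ ?_
    by_cases hj : j = k
    · subst hj
      exact hr i m (by simpa [State.local] using hm)
    · exact h.rcvd j i m (by simpa [State.local, hj] using hm)
  · refine le_trans ?_ (hle.support o g v)
    by_cases hj : j = k
    · subst hj
      rcases hs.readied_new (by simpa [State.local] using hv) with h1 | h1
      · exact h.supp _ _ _ _ h1
      · exact h.support_of_quorum h1
    · exact h.supp j o g v (by simpa [State.local, hj] using hv)

/-- A step of the system takes control of a process, injects a packet, or is a step of a process. -/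
lemma exec_cases (h : GInv sec σ) (a : SPoly t K) (c : Cmd n t K) :
    exec sec a σ c = σ ∨
    (∃ i, i ∉ σ.corrupted ∧ σ.corrupted.card < t ∧
      exec sec a σ c = { σ with corrupted := insert i σ.corrupted }) ∨
    (∃ p : Packet n t K, p.src ∈ σ.corrupted ∧ exec sec a σ c = { σ with net := σ.net ++ [p] }) ∨
    (∃ k L' ps, LStep sec k (σ.loc k) L' ps ∧ (∀ j m, (j, m) ∈ L'.rcvd → ⟨j, k, m⟩ ∈ σ.net) ∧
      exec sec a σ c = σ.local k (L', ps)) := by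
  unfold exec
  split_ifs with he
  swap
  · exact Or.inl rfl
  cases c with
  | corrupt i => exact Or.inr (Or.inl ⟨i, he.1, he.2, rfl⟩)
  | inject p => exact Or.inr (Or.inr (Or.inl ⟨p, he, rfl⟩))
  | deliver m =>
    simp only [List.getElem?_eq_getElem he]
    refine Or.inr (Or.inr (Or.inr ⟨_, _, _, LStep.receive _ _, ?_, rfl⟩))
    intro j m' hm
    rw [Local.receive_rcvd] at hm
    rcases hm with hm | hm
    · cases hm
      exact List.getElem_mem he
    · exact h.rcvd _ _ _ hm
  | call k c =>
    refine Or.inr (Or.inr (Or.inr ⟨_, _, _, LStep.call a c he.2, ?_, rfl⟩))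
    intro j m hm
    rw [Call.run_rcvd] at hm
    exact h.rcvd _ _ _ hm
  | rule k ρ =>
    refine Or.inr (Or.inr (Or.inr ⟨_, _, _, LStep.rule ρ he.2, ?_, rfl⟩))
    intro j m hm
    rw [Rule.run_rcvd] at hm
    exact h.rcvd _ _ _ hm

/-- A controlled process no longer executes code; its memory changes only by receiving. So the
invariants of memories hold for all processes, and only `sound` has to exclude controlled senders,
who may inject anything. -/
lemma GInv.exec (h : GInv sec σ) (a : SPoly t K) (c : Cmd n t K) :
    GInv sec (exec sec a σ c) ∧ σ.Le (exec sec a σ c) := by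
  rcases exec_cases h a c with h0 | ⟨i, hi, hc, h0⟩ | ⟨p, hp, h0⟩ | ⟨k, L', ps, hs, hr, h0⟩ <;>
    rw [h0]
  · exact ⟨h, .refl _⟩
  · have hle : σ.Le { σ with corrupted := insert i σ.corrupted } :=
      ⟨Finset.subset_insert _ _, ⟨[], by simp⟩, fun _ => .refl _⟩
    refine ⟨⟨h.loc, h.out, fun p hp hpc => h.sound p hp fun hc => hpc ?_, h.rcvd, ?_,
      fun k o g v hv => (h.supp k o g v hv).trans (hle.support o g v)⟩, hle⟩
    · exact Finset.mem_insert_of_mem hc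
    · rw [Finset.card_insert_of_notMem hi]
      exact hc
  · refine ⟨⟨h.loc, fun k j => ?_, fun q hq hqc => ?_, fun k j m hm => ?_, h.card, h.supp⟩,
      ⟨subset_rfl, ⟨[p], rfl⟩, fun _ => .refl _⟩⟩
    · obtain ⟨h1, h2, h3, h4, h5⟩ := h.out k j
      exact ⟨fun J f hJ => List.mem_append_left _ (h1 J f hJ),
        fun J f hJ hf => List.mem_append_left _ (h2 J f hJ hf),
        fun g v hv => List.mem_append_left _ (h3 g v hv),
        fun o g v hv => List.mem_append_left _ (h4 o g v hv),
        fun o g v hv => List.mem_append_left _ (h5 o g v hv)⟩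
    · rcases List.mem_append.1 hq with hq | hq
      · exact h.sound q hq hqc
      · rw [List.mem_singleton] at hq
        subst hq
        exact absurd hp hqc
    · exact List.mem_append_left _ (h.rcvd k j m hm)
  · exact ⟨h.local hs hr, State.le_local h hs⟩

/-- Two quorums of echoes have an uncontrolled process in common. -/
lemma GInv.support_unique (hn : 3 * t < n) (h : GInv sec σ) {o g v v'}
    (h1 : n - t ≤ (σ.support o g v).card) (h2 : n - t ≤ (σ.support o g v').card) : v = v' := by
  have hi : n - 2 * t ≤ (σ.support o g v ∩ σ.support o g v').card := by
    have := Finset.card_union_add_card_inter (σ.support o g v) (σ.support o g v')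
    have hu := Finset.card_le_univ (σ.support o g v ∪ σ.support o g v')
    rw [Fintype.card_fin] at hu
    omega
  obtain ⟨j, hj, hc⟩ := h.exists_uncorrupted (s := σ.support o g v ∩ σ.support o g v') (by omega)
  simp only [State.support, Finset.mem_inter, Finset.mem_filter, hc, false_or] at hj
  exact Option.some_injective _ (hj.1.2.symm.trans hj.2.2)

lemma GInv.accepted_support (h : GInv sec σ) {k o g v} (hv : (σ.loc k).accepted o g = some v) :
    n - t ≤ (σ.support o g v).card := by
  have := (h.loc k).accepted o g v hv
  exact h.support_of_quorum (k := k) (Or.inr (by omega))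

/-- Agreement of A-Cast. -/
lemma GInv.accepted_unique (hn : 3 * t < n) (h : GInv sec σ) {k k' o g v v'}
    (hv : (σ.loc k).accepted o g = some v) (hv' : (σ.loc k').accepted o g = some v') : v = v' :=
  h.support_unique hn (h.accepted_support hv) (h.accepted_support hv')

/-- Integrity of A-Cast. -/
lemma GInv.cast_of_support (hn : 3 * t < n) (h : GInv sec σ) {o g v} (ho : o ∉ σ.corrupted)
    (hv : n - t ≤ (σ.support o g v).card) : (σ.loc o).cast g = some v := by
  obtain ⟨j, hj, hc⟩ := h.exists_uncorrupted (s := σ.support o g v) (by omega)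
  simp only [State.support, Finset.mem_filter, hc, false_or] at hj
  exact (h.sound _ (h.rcvd _ _ _ ((h.loc j).echoed _ _ _ hj.2)) ho).2

lemma GInv.cast_of_accepted (hn : 3 * t < n) (h : GInv sec σ) {k o g v} (ho : o ∉ σ.corrupted)
    (hv : (σ.loc k).accepted o g = some v) : (σ.loc o).cast g = some v :=
  h.cast_of_support hn ho (h.accepted_support hv)

end System

/-! ### Executions -/

section Executions

variable {n t : ℕ} {K : Type} [Field K] (R : Run n t K)

lemma Run.inv (τ : ℕ) : GInv R.secret (R.st τ) := by
  induction τ with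
  | zero => rw [R.st_zero]; exact .start _
  | succ τ ih => rw [R.st_succ]; exact (ih.exec _ _).1

lemma Run.le {τ τ' : ℕ} (h : τ ≤ τ') : (R.st τ).Le (R.st τ') := by
  induction h with
  | refl => exact .refl _
  | step _ ih => rw [Nat.succ_eq_add_one, R.st_succ]; exact ih.trans ((R.inv _).exec _ _).2

lemma Run.at_le {τ τ' : ℕ} (h : τ ≤ τ') (k : Fin n) : (R.at τ k).Le (R.at τ' k) := (R.le h).loc k

lemma Run.linv (τ : ℕ) (k : Fin n) : LInv R.secret k (R.at τ k) := (R.inv τ).loc k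

/-- The set of the correct processes. -/
def Run.good : Finset (Fin n) := Finset.univ.filter R.Correct

lemma Run.mem_good {k : Fin n} : k ∈ R.good ↔ R.Correct k := by simp [good]

lemma Run.card_good : n - t ≤ R.good.card := by
  have h : ∀ k, ∃ τ, ¬ R.Correct k → k ∈ (R.st τ).corrupted := by
    intro k
    by_cases hk : R.Correct k
    · exact ⟨0, fun h => absurd hk h⟩
    · simp only [Correct, not_forall, not_not] at hk
      exact hk.imp fun τ h _ => h
  choose τ hτ using h
  -- There are finitely many processes, so at the latest of the corruption times all faulty ones are
  -- controlled at once, and the bound `t` applies to them together.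
  have hsub : R.goodᶜ ⊆ (R.st (Finset.univ.sup τ)).corrupted := by
    intro k hk
    rw [Finset.mem_compl, R.mem_good] at hk
    exact (R.le (Finset.le_sup (Finset.mem_univ k))).corrupted (hτ k hk)
  have h1 := (Finset.card_le_card hsub).trans (R.inv _).card
  rw [Finset.card_compl, Fintype.card_fin] at h1
  omega

/-- A set with `n - t` elements has at least `n - 2 * t` correct elements. -/
lemma Run.card_inter_good {M : Finset (Fin n)} (hM : n - t ≤ M.card) :
    n - 2 * t ≤ (M ∩ R.good).card := by
  have h1 := R.card_good
  have h2 := Finset.card_union_add_card_inter M R.good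
  have h3 := Finset.card_le_univ (M ∪ R.good)
  rw [Fintype.card_fin] at h3
  omega

variable {R}

/-- Properties of a memory that are preserved when the memory is extended. -/
def Stable (P : Local n t K → Prop) : Prop := ∀ L L', L.Le L' → P L → P L'

lemma Stable.eventually {P : Local n t K → Prop} (hP : Stable P) {τ : ℕ} {k : Fin n}
    (h : P (R.at τ k)) : ∀ᶠ τ in atTop, P (R.at τ k) :=
  eventually_atTop.2 ⟨τ, fun _ h' => hP _ _ (R.at_le h' k) h⟩

lemma stable_ne {α : Type} {F : Local n t K → Option α}
    (h : ∀ L L' : Local n t K, L.Le L' → ∀ x, F L = some x → F L' = some x) :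
    Stable fun L : Local n t K => F L ≠ none := by
  intro L L' hle hL
  obtain ⟨x, hx⟩ := Option.ne_none_iff_exists'.1 hL
  show F L' ≠ none
  rw [h L L' hle x hx]
  simp

/-- A step that stays enabled until it has been executed is executed. -/
lemma Run.Fair.does (hF : R.Fair) {k : Fin n} (hk : R.Correct k) (ρ : Rule n t K)
    {Done : Local n t K → Prop} (hD : Stable Done)
    (hrun : ∀ L, ρ.Guard k L → Done (ρ.run k L).1)
    (hg : ∀ᶠ τ in atTop, ρ.Guard k (R.at τ k) ∨ Done (R.at τ k)) :
    ∀ᶠ τ in atTop, Done (R.at τ k) := by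
  -- If the effect never occurred, the step would stay enabled from some time on, and fairness would
  -- execute it.
  by_contra hc
  have hnever : ∀ τ, ¬ Done (R.at τ k) := fun τ h => hc (hD.eventually h)
  obtain ⟨τ₀, h₀⟩ := eventually_atTop.1 hg
  have hen : ∀ τ, τ₀ ≤ τ → (Cmd.rule k ρ).Enabled (R.st τ) := fun τ hτ =>
    ⟨hk τ, (h₀ τ hτ).resolve_right (hnever τ)⟩
  obtain ⟨τ, hτ, hcmd⟩ := hF.progress k ρ τ₀ hk hen
  refine hnever (τ + 1) ?_
  have : R.at (τ + 1) k = (ρ.run k (R.at τ k)).1 := by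
    rw [Run.at, R.st_succ, hcmd, exec, if_pos (hen τ hτ)]
    simp [State.local, Run.at]
  rw [this]
  exact hrun _ (hen τ hτ).2

lemma Run.Fair.receives (hF : R.Fair) {τ : ℕ} {p : Packet n t K} (hp : p ∈ (R.st τ).net)
    (hk : R.Correct p.dst) : ∀ᶠ τ in atTop, (p.src, p.msg) ∈ (R.at τ p.dst).rcvd := by
  obtain ⟨m, hm⟩ := List.mem_iff_getElem?.1 hp
  obtain ⟨τ', hτ, hcmd⟩ := hF.delivery τ m p hm hk
  have hm' : (R.st τ').net[m]? = some p := by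
    obtain ⟨l, hl⟩ := (R.le hτ).net
    rw [hl, List.getElem?_append_left (List.getElem?_eq_some_iff.1 hm).1, hm]
  refine Stable.eventually (P := fun L : Local n t K => (p.src, p.msg) ∈ L.rcvd)
    (fun L L' h => h.rcvd _) (τ := τ' + 1) ?_
  have : (Cmd.deliver m : Cmd n t K).Enabled (R.st τ') := (List.getElem?_eq_some_iff.1 hm').1
  rw [Run.at, R.st_succ, hcmd, exec, if_pos this]
  simp [hm', State.local, Local.receive_rcvd]

/-- Every correct process eventually outputs `v` in the A-Cast of `o` under the heading `g`. -/
def Run.Accepts (R : Run n t K) (o : Fin n) (g : Tag n) (v : Val n t K) : Prop :=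
  ∀ k, R.Correct k → ∀ᶠ τ in atTop, (R.at τ k).accepted o g = some v

lemma Run.good_card_le_senders (hF : R.Fair) {k : Fin n} (hk : R.Correct k) {m : Msg n t K}
    (h : ∀ j, R.Correct j → ∃ τ, ⟨j, k, m⟩ ∈ (R.st τ).net) :
    ∀ᶠ τ in atTop, n - t ≤ ((R.at τ k).senders m).card := by
  have h1 : ∀ᶠ τ in atTop, ∀ j ∈ R.good, (j, m) ∈ (R.at τ k).rcvd := by
    rw [Filter.eventually_all_finset]
    intro j hj
    obtain ⟨τ, hτ⟩ := h j (R.mem_good.1 hj)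
    exact hF.receives hτ hk
  filter_upwards [h1] with τ hτ
  refine R.card_good.trans (Finset.card_le_card fun j hj => ?_)
  simpa [Local.senders] using hτ j hj

/-- Common core of totality and validity. Every correct process is driven to send `ready`,
necessarily for `v`; these `n - t ≥ 2t + 1` messages make everyone accept. -/
lemma Run.Fair.accepts_of_quorums (hn : 3 * t < n) (hF : R.Fair) {o : Fin n} {g : Tag n}
    {v : Val n t K}
    (h : ∀ k, R.Correct k → ∃ τ, n - t ≤ ((R.at τ k).senders (.acEcho o g v)).card ∨
      t + 1 ≤ ((R.at τ k).senders (.acReady o g v)).card) : R.Accepts o g v := by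
  have hsupp : ∀ k, R.Correct k → ∃ τ, n - t ≤ ((R.st τ).support o g v).card := fun k hk =>
    (h k hk).imp fun τ hτ => (R.inv τ).support_of_quorum hτ
  -- A process may already have sent `ready` or accepted before the quorum arrived; any such value
  -- has a support too and hence equals `v`.
  have huniq : ∀ k, R.Correct k → ∀ τ v', n - t ≤ ((R.st τ).support o g v').card → v' = v := by
    intro k hk τ v' hv'
    obtain ⟨τ', hτ'⟩ := hsupp k hk
    exact (R.inv (max τ τ')).support_unique hn
      (hv'.trans ((R.le (le_max_left τ τ')).support o g v'))
      (hτ'.trans ((R.le (le_max_right τ τ')).support o g v))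
  have hready : ∀ k, R.Correct k → ∃ τ, (R.at τ k).readied o g = some v := by
    intro k hk
    obtain ⟨τ₀, h₀⟩ := h k hk
    have hdone : ∀ᶠ τ in atTop, (R.at τ k).readied o g ≠ none := by
      refine hF.does hk (.ready o g v) (stable_ne fun _ _ h => h.readied o g)
        (fun L _ => by simp [Rule.run]) ?_
      filter_upwards [eventually_ge_atTop τ₀] with τ hτ
      by_cases hr : (R.at τ k).readied o g = none
      · left
        have hle := R.at_le hτ k
        simp only [Rule.Guard, Local.count_eq]
        exact ⟨hr, h₀.imp (fun x => x.trans (hle.senders _)) (fun x => x.trans (hle.senders _))⟩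
      · exact Or.inr hr
    obtain ⟨τ, hτ⟩ := hdone.exists
    obtain ⟨v', hv'⟩ := Option.ne_none_iff_exists'.1 hτ
    have := huniq k hk τ v' ((R.inv τ).supp k o g v' hv')
    exact ⟨τ, this ▸ hv'⟩
  intro k hk
  have hcount := Run.good_card_le_senders hF hk (m := .acReady o g v) fun j hj => by
    obtain ⟨τ, hτ⟩ := hready j hj
    exact ⟨τ, (((R.inv τ).out j) k).2.2.2.2 o g v hτ⟩
  have hdone : ∀ᶠ τ in atTop, (R.at τ k).accepted o g ≠ none := by
    refine hF.does hk (.accept o g v) (stable_ne fun _ _ h => h.accepted o g)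
      (fun L _ => by simp [Rule.run]) ?_
    filter_upwards [hcount] with τ hτ
    by_cases hr : (R.at τ k).accepted o g = none
    · left
      simp only [Rule.Guard, Local.count_eq]
      exact ⟨hr, by omega⟩
    · exact Or.inr hr
  filter_upwards [hdone] with τ hτ
  obtain ⟨v', hv'⟩ := Option.ne_none_iff_exists'.1 hτ
  rw [hv', huniq k hk τ v' ((R.inv τ).accepted_support hv')]

/-- Totality of A-Cast. -/
lemma Run.Fair.accepts_of_accepted (hn : 3 * t < n) (hF : R.Fair) {k : Fin n} {τ : ℕ} {o g v}
    (h : (R.at τ k).accepted o g = some v) : R.Accepts o g v := by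
  refine hF.accepts_of_quorums hn fun k' hk' => ?_
  have hq := (R.linv τ k).accepted o g v h
  -- At least `t + 1` of the `2t + 1` senders are correct, and these have sent `ready` to everybody.
  have h1 : ∀ᶠ τ' in atTop, ∀ j ∈ (R.at τ k).senders (.acReady o g v) ∩ R.good,
      (j, .acReady o g v) ∈ (R.at τ' k').rcvd := by
    rw [Filter.eventually_all_finset]
    intro j hj
    rw [Finset.mem_inter, R.mem_good] at hj
    have hs := ((R.inv τ).senders_sent hj.1).resolve_left (hj.2 τ)
    exact hF.receives (((R.inv τ).out j k').2.2.2.2 o g v hs) hk'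
  obtain ⟨τ', hτ'⟩ := h1.exists
  refine ⟨τ', Or.inr ?_⟩
  refine le_trans ?_ (Finset.card_le_card
    (s := (R.at τ k).senders (.acReady o g v) ∩ R.good) fun j hj => ?_)
  · have h2 := Finset.card_union_add_card_inter ((R.at τ k).senders (.acReady o g v)) R.good
    have h3 := Finset.card_le_univ ((R.at τ k).senders (.acReady o g v) ∪ R.good)
    have h4 := R.card_good
    rw [Fintype.card_fin] at h3
    omega
  · simpa [Local.senders] using hτ' j hj

/-- Validity of A-Cast. -/
lemma Run.Fair.accepts_of_cast (hn : 3 * t < n) (hF : R.Fair) {o : Fin n} (ho : R.Correct o)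
    {τ : ℕ} {g v} (h : (R.at τ o).cast g = some v) : R.Accepts o g v := by
  have hecho : ∀ k, R.Correct k → ∃ τ, (R.at τ k).echoed o g = some v := by
    intro k hk
    have hrcv := hF.receives (((R.inv τ).out o k).2.2.1 g v h) hk
    have hdone : ∀ᶠ τ in atTop, (R.at τ k).echoed o g ≠ none := by
      refine hF.does hk (.echo o g v) (stable_ne fun _ _ h => h.echoed o g)
        (fun L _ => by simp [Rule.run]) ?_
      filter_upwards [hrcv] with τ hτ
      by_cases hr : (R.at τ k).echoed o g = none
      · exact Or.inl ⟨hr, hτ⟩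
      · exact Or.inr hr
    obtain ⟨τ', hτ', hge⟩ := (hdone.and (eventually_ge_atTop τ)).exists
    obtain ⟨v', hv'⟩ := Option.ne_none_iff_exists'.1 hτ'
    have h1 := ((R.inv τ').sound _ ((R.inv τ').rcvd _ _ _ ((R.linv τ' k).echoed o g v' hv'))
      (ho τ')).2
    have h2 := (R.at_le hge o).cast _ _ h
    refine ⟨τ', ?_⟩
    rw [hv', ← h2, ← h1]
    rfl
  refine hF.accepts_of_quorums hn fun k hk => ?_
  obtain ⟨τ', hτ'⟩ := (Run.good_card_le_senders hF hk (m := .acEcho o g v) fun j hj => by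
    obtain ⟨τ, hτ⟩ := hecho j hj
    exact ⟨τ, (((R.inv τ).out j) k).2.2.2.1 o g v hτ⟩).exists
  exact ⟨τ', Or.inl hτ'⟩

/-- Agreement and integrity of A-Cast, at different times. -/
lemma Run.accepted_unique (hn : 3 * t < n) {τ τ' : ℕ} {k k' o : Fin n} {g v v'}
    (h : (R.at τ k).accepted o g = some v) (h' : (R.at τ' k').accepted o g = some v') : v = v' :=
  (R.inv (max τ τ')).accepted_unique hn ((R.at_le (le_max_left τ τ') k).accepted _ _ _ h)
    ((R.at_le (le_max_right τ τ') k').accepted _ _ _ h')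

lemma Run.cast_of_accepted (hn : 3 * t < n) {τ : ℕ} {k o : Fin n} {g v} (ho : R.Correct o)
    (h : (R.at τ k).accepted o g = some v) : (R.at τ o).cast g = some v :=
  (R.inv τ).cast_of_accepted hn (ho τ) h

end Executions

/-! ### Consistency of the polynomials of uncontrolled processes -/

section Consistency

variable {n t : ℕ} {K : Type} [Field K] {sec : Inst n → K} {σ : State n t K}

/-- Process `i` compared its row with the share received from `j`, and an uncontrolled `j` computed
that share from its own row. -/
lemma GInv.equal_consistent (h : GInv sec σ) {J : Inst n} {i j : Fin n} {v}
    (hj : j ∉ σ.corrupted) (hc : (σ.loc i).cast (.equal J j) = some v) :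
    ∃ fi fj, (σ.loc i).row J = some fi ∧ (σ.loc j).row J = some fj ∧
      fi.eval (pt K j) = fj.eval (pt K i) := by
  obtain ⟨-, f, x, h1, h2, h3⟩ := (h.loc i).cast _ _ hc
  obtain ⟨fj, h4, h5⟩ := h.sound _ (h.rcvd _ _ _ h2) hj
  exact ⟨f, fj, h1, h4, h3.trans h5⟩

/-- Integrity of A-Cast traces the accepted "equal" message back to `i`. The case `i = j` is allowed
and shows that an uncontrolled member has a row. -/
lemma GInv.goodCand_consistent (hn : 3 * t < n) (h : GInv sec σ) {k : Fin n} {J : Inst n} {M}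
    (hM : (σ.loc k).GoodCand J M) {i j : Fin n} (hi : i ∈ M) (hj : j ∈ M) (hic : i ∉ σ.corrupted)
    (hjc : j ∉ σ.corrupted) :
    ∃ fi fj, (σ.loc i).row J = some fi ∧ (σ.loc j).row J = some fj ∧
      fi.eval (pt K j) = fj.eval (pt K i) :=
  h.equal_consistent hjc (h.cast_of_accepted hn hic (hM.2.1 i hi j hj))

/-- The polynomials of the uncontrolled members of a candidate set define a bivariate polynomial. -/
lemma GInv.exists_spoly (hK : Set.InjOn (fun m : ℕ => (m : K)) (Set.Iic n)) (hn : 3 * t < n)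
    (h : GInv sec σ) {k : Fin n} {J : Inst n} {M} (hM : (σ.loc k).GoodCand J M) :
    ∃ F : SPoly t K, ∀ i ∈ M, i ∉ σ.corrupted →
      (σ.loc i).row J = some (F.slice (pt K i)) := by
  have hcard : t < (M \ σ.corrupted).card := by
    have := Finset.le_card_sdiff σ.corrupted M
    have := h.card
    have := hM.1
    omega
  -- The default `0` is never used, because uncontrolled members of `M` have rows.
  obtain ⟨F, hF⟩ := exists_spoly_slice (pt_injective (n := n) hK) hcard
    (fun i => ((σ.loc i).row J).getD 0) (by
      intro i hi j hj
      rw [Finset.mem_sdiff] at hi hj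
      obtain ⟨fi, fj, h1, h2, h3⟩ := h.goodCand_consistent hn hM hi.1 hj.1 hi.2 hj.2
      simpa [h1, h2] using h3)
  refine ⟨F, fun i hi hic => ?_⟩
  obtain ⟨fi, -, h1, -, -⟩ := h.goodCand_consistent hn hM hi hi hic hic
  have := hF i (Finset.mem_sdiff.2 ⟨hi, hic⟩)
  rw [h1, this, h1]
  rfl

lemma GInv.row_of_hasPoly (hn : 3 * t < n) (h : GInv sec σ) {k i : Fin n} {J : Inst n} {f}
    (hi : i ∉ σ.corrupted) (hf : (σ.loc k).HasPoly J i f) : (σ.loc i).row J = some f := by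
  obtain ⟨-, ⟨f', h1, h2⟩, -⟩ := (h.loc i).cast _ _ (h.cast_of_accepted hn hi hf)
  cases h2
  exact h1

/-- The pairs that are inferred are faulty. -/
lemma GInv.not_infers (hn : 3 * t < n) (h : GInv sec σ) {k i j : Fin n} {J : Inst n}
    (hi : i ∉ σ.corrupted) (hj : j ∉ σ.corrupted) : ¬ (σ.loc k).Infers J s(i, j) := by
  rintro ⟨-, M, hM, i', hi', j', hj', fi, fj, he, h1, h2, h3⟩
  have hc : i' ∉ σ.corrupted ∧ j' ∉ σ.corrupted := by
    rw [Sym2.eq_iff] at he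
    rcases he with ⟨rfl, rfl⟩ | ⟨rfl, rfl⟩ <;> exact ⟨by assumption, by assumption⟩
  -- Having revealed, `i'` had completed the sharing with a checked candidate set, which agreement
  -- identifies with `M`.
  have hd := ((h.loc i').cast _ _ (h.cast_of_accepted hn hc.1 h1)).1
  obtain ⟨M', hM', hG⟩ := (h.loc i').doneS J hd
  have : M' = M := by
    have := h.accepted_unique hn hM' hM
    cases this
    rfl
  subst this
  obtain ⟨gi, gj, h4, h5, h6⟩ := h.goodCand_consistent hn hG hi' hj' hc.1 hc.2
  have h7 := h.row_of_hasPoly hn hc.1 h1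
  have h8 := h.row_of_hasPoly hn hc.2 h2
  rw [h4] at h7
  rw [h5] at h8
  cases h7
  cases h8
  exact h3 h6

end Consistency

/-! ### Termination -/

section Termination

variable {n t : ℕ} {K : Type} [Field K] {R : Run n t K}

lemma Run.Fair.goodCand (hn : 3 * t < n) (hF : R.Fair) {τ₀ : ℕ} {k₀ : Fin n} {I : Inst n} {M}
    (hM : (R.at τ₀ k₀).GoodCand I M) {k : Fin n} (hk : R.Correct k) :
    ∀ᶠ τ in atTop, (R.at τ k).GoodCand I M := by
  have h1 : ∀ᶠ τ in atTop, ∀ i ∈ M, ∀ j ∈ M, (R.at τ k).accepted i (.equal I j) = some .unit := by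
    simp only [Filter.eventually_all_finset]
    exact fun i hi j hj => hF.accepts_of_accepted hn (hM.2.1 i hi j hj) k hk
  have h2 : ∀ᶠ τ in atTop, ∀ i ∈ M, ∀ j ∈ M, ∀ p ∈ M, ∀ q ∈ M,
      (R.at τ k).accepted p (.checked I.round q s(i, j)) = some .unit := by
    simp only [Filter.eventually_all_finset]
    exact fun i hi j hj p hp q hq =>
      hF.accepts_of_accepted hn (hM.2.2 i hi j hj p hp q hq) k hk
  filter_upwards [h1, h2] with τ h1 h2
  exact ⟨hM.1, h1, h2⟩

lemma Run.Fair.hasCand (hn : 3 * t < n) (hF : R.Fair) {τ₀ : ℕ} {k₀ : Fin n} {I : Inst n} {M}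
    (hM : (R.at τ₀ k₀).HasCand I M) {k : Fin n} (hk : R.Correct k) :
    ∀ᶠ τ in atTop, (R.at τ k).HasCand I M :=
  hF.accepts_of_accepted hn hM k hk

/-- The receipt of `M` and the conditions on `M` may be witnessed by different processes at
different times; totality brings both to `k`. Reported instances are admitted because they must be
completed in later rounds too. -/
lemma Run.Fair.completesS_of_cand (hn : 3 * t < n) (hF : R.Fair) {τ₀ τ₁ : ℕ} {k₀ k₁ : Fin n}
    {I : Inst n} {M} (hM : (R.at τ₀ k₀).HasCand I M) (hG : (R.at τ₁ k₁).GoodCand I M) {k : Fin n}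
    (hk : R.Correct k) (hp : ∀ᶠ τ in atTop,
      ((R.at τ k).PartS I ∨ (R.at τ k).Reported I) ∨ I ∈ (R.at τ k).doneS) :
    ∀ᶠ τ in atTop, I ∈ (R.at τ k).doneS := by
  refine hF.does hk (.completeS I) (fun _ _ h => h.doneS I) (fun L _ => by simp [Rule.run]) ?_
  filter_upwards [hp, hF.hasCand hn hM hk, hF.goodCand hn hG hk] with τ h1 h2 h3
  by_cases hd : I ∈ (R.at τ k).doneS
  · exact Or.inr hd
  · exact Or.inl ⟨h1.resolve_right hd, hd, M, h2, h3⟩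

lemma Run.Fair.completesS_of_doneS (hn : 3 * t < n) (hF : R.Fair) {τ₀ : ℕ} {k₀ : Fin n}
    {I : Inst n} (h0 : I ∈ (R.at τ₀ k₀).doneS) {k : Fin n} (hk : R.Correct k)
    (hp : ∀ᶠ τ in atTop,
      ((R.at τ k).PartS I ∨ (R.at τ k).Reported I) ∨ I ∈ (R.at τ k).doneS) :
    ∀ᶠ τ in atTop, I ∈ (R.at τ k).doneS := by
  obtain ⟨M, h1, h2⟩ := (R.linv τ₀ k₀).doneS I h0
  exact hF.completesS_of_cand hn h1 h2 hk hp

lemma Run.KeepsS.eventually {I : Inst n} {k : Fin n} (h : R.KeepsS I k) :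
    ∀ᶠ τ in atTop, ((R.at τ k).PartS I ∨ (R.at τ k).Reported I) ∨ I ∈ (R.at τ k).doneS := by
  obtain ⟨τ, hτ⟩ := h
  exact eventually_atTop.2 ⟨τ, fun τ' h' => (hτ τ' h').imp_left Or.inl⟩

lemma Run.KeepsR.eventually {I : Inst n} {k : Fin n} (h : R.KeepsR I k) :
    ∀ᶠ τ in atTop, (R.at τ k).PartR I ∨ (R.at τ k).output I ≠ none :=
  eventually_atTop.2 h

lemma termination2 (hn : 3 * t < n) (I : Inst n) : Termination2 n t K I := by
  rintro R hF ⟨k₀, -, τ₀, h₀⟩ k hk hS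
  exact (hF.completesS_of_doneS hn h₀ hk hS.eventually).exists

/-- A correct member of the candidate set A-Casts its polynomial when it executes Step 1 of the
reconstruction protocol. -/
lemma Run.Fair.reveals (hn : 3 * t < n) (hF : R.Fair) {τ₀ : ℕ} {k₀ : Fin n} {I : Inst n} {M}
    (hM : (R.at τ₀ k₀).HasCand I M) (hG : (R.at τ₀ k₀).GoodCand I M) {i : Fin n} (hi : R.Correct i)
    (hiM : i ∈ M)
    (hp : ∀ᶠ τ in atTop, ((R.at τ i).PartR I ∨ (R.at τ i).Reported I) ∧ I ∈ (R.at τ i).doneS) :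
    ∃ f, R.Accepts i (.poly I) (.poly f) := by
  obtain ⟨f, -, hf, -, -⟩ := (R.inv τ₀).goodCand_consistent hn hG hiM hiM (hi τ₀) (hi τ₀)
  have hdone : ∀ᶠ τ in atTop, (R.at τ i).cast (.poly I) ≠ none := by
    refine hF.does hi (.reveal I) (stable_ne fun _ _ h => h.cast _) (fun L hL => ?_) ?_
    · obtain ⟨f, hf⟩ := Option.ne_none_iff_exists'.1 hL.2.2.2.1
      simp [Rule.run, hf, Local.acast]
    · filter_upwards [hp, hF.hasCand hn hM hi, eventually_ge_atTop τ₀] with τ h1 h2 h3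
      by_cases hd : (R.at τ i).cast (.poly I) = none
      · refine Or.inl ⟨h1.1, h1.2, hd, ?_, M, h2, hiM⟩
        rw [(R.at_le h3 i).row I f hf]
        simp
      · exact Or.inr hd
  obtain ⟨τ, hτ⟩ := hdone.exists
  obtain ⟨v, hv⟩ := Option.ne_none_iff_exists'.1 hτ
  obtain ⟨-, ⟨f, -, rfl⟩, -⟩ := (R.linv τ i).cast _ _ hv
  exact ⟨f, hF.accepts_of_cast hn hi hv⟩

/-- The instances in the sets `CoreInvocations` of correct processes are completed and revealed by
all correct processes. -/
lemma Run.Fair.core_revealed (hn : 3 * t < n) (hF : R.Fair) {l : Fin n} (hl : R.Correct l) {τ₀ r : ℕ}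
    {S : Finset (Inst n)} (hS : (R.at τ₀ l).cast (.core r) = some (.insts S)) {J : Inst n}
    (hJ : J ∈ S) :
    ∃ M, (R.at τ₀ l).HasCand J M ∧ (R.at τ₀ l).GoodCand J M ∧
      (∀ k, R.Correct k → ∀ᶠ τ in atTop, (R.at τ k).Reported J) ∧
      (∀ i ∈ M, R.Correct i → ∃ f, R.Accepts i (.poly J) (.poly f)) := by
  obtain ⟨-, S', hS', hcore⟩ := (R.linv τ₀ l).cast _ _ hS
  cases hS'
  obtain ⟨rfl, hJc⟩ := hcore J hJ
  obtain ⟨x, hx⟩ := (R.linv τ₀ l).core J hJc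
  have hdone := ((R.linv τ₀ l).value J x hx).2.1
  obtain ⟨M, hM, hG⟩ := (R.linv τ₀ l).doneS J hdone
  have hrep : ∀ k, R.Correct k → ∀ᶠ τ in atTop, (R.at τ k).Reported J := by
    intro k hk
    filter_upwards [hF.accepts_of_cast hn hl hS k hk] with τ hτ
    exact ⟨l, S, hτ, hJ⟩
  refine ⟨M, hM, hG, hrep, fun i hi hic => hF.reveals hn hM hG hic hi ?_⟩
  have hcomp := hF.completesS_of_doneS hn hdone hic ((hrep i hic).mono fun τ h => Or.inl (Or.inr h))
  filter_upwards [hrep i hic, hcomp] with τ h1 h2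
  exact ⟨Or.inr h1, h2⟩

/-- The candidate set, the interpolated polynomials and the "ready to complete" messages used by
`k₀` are all A-Cast, so `k` can use the same interpolation set, the same polynomial and the same
quorum. -/
lemma termination4 (hn : 3 * t < n) (I : Inst n) : Termination4 n t K I := by
  rintro R hF ⟨k₀, hk₀, τ₀, h₀⟩ k hk hR
  obtain ⟨x, hx⟩ := Option.ne_none_iff_exists'.1 h₀
  obtain ⟨hv, hq⟩ := (R.linv τ₀ k₀).output I x hx
  obtain ⟨-, -, -, IS, f, M, -, hM, hIS, hcard, hpoly⟩ := (R.linv τ₀ k₀).value I x hv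
  have hp := hR.eventually
  have hpolys : ∀ᶠ τ in atTop, ∀ i ∈ IS, ∃ fi, (R.at τ k).HasPoly I i fi ∧
      ∀ j ∈ M, f.eval (pt K i) (pt K j) = fi.eval (pt K j) := by
    rw [Filter.eventually_all_finset]
    intro i hi
    obtain ⟨fi, h1, h2⟩ := hpoly i hi
    filter_upwards [hF.accepts_of_accepted hn h1 k hk] with τ hτ
    exact ⟨fi, hτ, h2⟩
  have hval : ∀ᶠ τ in atTop, (R.at τ k).value I ≠ none := by
    refine hF.does hk (.interpolate I IS f) (stable_ne fun _ _ h => h.value I)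
      (fun L _ => by simp [Rule.run, Local.acast]) ?_
    filter_upwards [hp, hpolys, hF.hasCand hn hM hk] with τ h1 h2 h3
    by_cases hv : (R.at τ k).value I = none
    · rcases h1 with h1 | h1
      · exact Or.inl ⟨h1, hv, M, h3, hIS, hcard, h2⟩
      · obtain ⟨y, hy⟩ := Option.ne_none_iff_exists'.1 h1
        rw [((R.linv τ k).output I y hy).1] at hv
        cases hv
    · exact Or.inr hv
  have hready : ∀ᶠ τ in atTop, ∀ j ∈ (R.at τ₀ k₀).readySet I,
      (R.at τ k).accepted j (.ready I) = some .unit := by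
    rw [Filter.eventually_all_finset]
    intro j hj
    exact hF.accepts_of_accepted (k := k₀) (τ := τ₀) hn (by simpa [Local.readySet] using hj) k hk
  have hout : ∀ᶠ τ in atTop, (R.at τ k).output I ≠ none := by
    refine hF.does hk (.finish I) (stable_ne fun _ _ h => h.output I)
      (fun L hL => by simpa [Rule.run] using hL.2.2.1) ?_
    filter_upwards [hp, hval, hready] with τ h1 h2 h3
    by_cases ho : (R.at τ k).output I = none
    · refine Or.inl ⟨h1.resolve_right (by simp [ho]), ho, h2, ?_⟩
      rw [Local.readySet_card]
      refine hq.trans (Finset.card_le_card fun j hj => ?_)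
      simpa [Local.readySet] using h3 j hj
    · exact Or.inr ho
  exact hout.exists

/-- If some correct process completes, `termination4` applies. Otherwise all correct processes
participate forever, the `n - 2t` correct members of `M` reveal slices of one polynomial, everyone
can interpolate with it, and all announce readiness. -/
lemma termination3 (hK : Set.InjOn (fun m : ℕ => (m : K)) (Set.Iic n)) (hn : 3 * t < n)
    (I : Inst n) : Termination3 n t K I := by
  rintro R hF ⟨k₀, hk₀, τ₀, h₀⟩ hR
  by_cases hc : ∃ k, R.Correct k ∧ R.CompletesR I k
  · exact fun k hk => termination4 hn I R hF hc k hk (hR k hk)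
  exfalso
  have hp : ∀ k, R.Correct k → ∀ᶠ τ in atTop, (R.at τ k).PartR I := fun k hk =>
    (hR k hk).eventually.mono fun τ h => h.resolve_right fun ho => hc ⟨k, hk, τ, ho⟩
  obtain ⟨M, hM, hG⟩ := (R.linv τ₀ k₀).doneS I h₀
  have hrev : ∀ i ∈ M, R.Correct i → ∃ f, R.Accepts i (.poly I) (.poly f) := by
    intro i hi hic
    refine hF.reveals hn hM hG hic hi ((hp i hic).mono fun τ h => ⟨Or.inl h, ?_⟩)
    exact (R.linv τ i).inR I h.1
  obtain ⟨F, hrow⟩ := (R.inv τ₀).exists_spoly hK hn hG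
  obtain ⟨IS, hIS, hcard⟩ := Finset.exists_subset_card_eq (R.card_inter_good hG.1.ge)
  have hval : ∀ k, R.Correct k → ∃ τ, (R.at τ k).value I ≠ none := by
    intro k hk
    have hpolys : ∀ᶠ τ in atTop, ∀ i ∈ IS, ∃ fi, (R.at τ k).HasPoly I i fi ∧
        ∀ j ∈ M, F.eval (pt K i) (pt K j) = fi.eval (pt K j) := by
      rw [Filter.eventually_all_finset]
      intro i hi
      obtain ⟨hiM, hig⟩ := Finset.mem_inter.1 (hIS hi)
      rw [R.mem_good] at hig
      obtain ⟨fi, hfi⟩ := hrev i hiM hig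
      filter_upwards [hfi k hk, eventually_ge_atTop τ₀] with τ h1 h2
      refine ⟨fi, h1, fun j _ => ?_⟩
      have h3 := (R.inv τ).row_of_hasPoly hn (hig τ) h1
      rw [(R.le h2).loc i |>.row I _ (hrow i hiM (hig τ₀))] at h3
      cases h3
      rw [SPoly.slice_eval]
    refine Eventually.exists (hF.does hk (.interpolate I IS F) (stable_ne fun _ _ h => h.value I)
      (fun L _ => by simp [Rule.run, Local.acast]) ?_)
    filter_upwards [hp k hk, hpolys, hF.hasCand hn hM hk] with τ h1 h2 h3
    by_cases hv : (R.at τ k).value I = none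
    · exact Or.inl ⟨h1, hv, M, h3, hIS.trans Finset.inter_subset_left, hcard, h2⟩
    · exact Or.inr hv
  have hready : ∀ᶠ τ in atTop, ∀ j ∈ R.good, (R.at τ k₀).accepted j (.ready I) = some .unit := by
    rw [Filter.eventually_all_finset]
    intro j hj
    obtain ⟨τ, hτ⟩ := hval j (R.mem_good.1 hj)
    obtain ⟨x, hx⟩ := Option.ne_none_iff_exists'.1 hτ
    exact hF.accepts_of_cast hn (R.mem_good.1 hj) ((R.linv τ j).value I x hx).2.2.1 k₀ hk₀
  have hval₀ : ∀ᶠ τ in atTop, (R.at τ k₀).value I ≠ none := by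
    obtain ⟨τ, hτ⟩ := hval k₀ hk₀
    exact Stable.eventually (stable_ne fun _ _ h => h.value I) hτ
  have hout : ∀ᶠ τ in atTop, (R.at τ k₀).output I ≠ none := by
    refine hF.does hk₀ (.finish I) (stable_ne fun _ _ h => h.output I)
      (fun L hL => by simpa [Rule.run] using hL.2.2.1) ?_
    filter_upwards [hp k₀ hk₀, hval₀, hready] with τ h1 h2 h3
    by_cases ho : (R.at τ k₀).output I = none
    · refine Or.inl ⟨h1, ho, h2, ?_⟩
      rw [Local.readySet_card]
      refine R.card_good.trans (Finset.card_le_card fun j hj => ?_)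
      simpa [Local.readySet] using h3 j hj
    · exact Or.inr ho
  obtain ⟨τ, hτ⟩ := hout.exists
  exact hc ⟨k₀, hk₀, τ, hτ⟩

/-- Correct processes certify pairs of correct processes. -/
lemma Run.Fair.certifies (hn : 3 * t < n) (hF : R.Fair) {p q i j : Fin n} (hp : R.Correct p)
    (hq : R.Correct q) (hi : R.Correct i) (hj : R.Correct j) {r τ₀ : ℕ}
    (hr : r ≤ (R.at τ₀ q).round) : R.Accepts p (.checked r q s(i, j)) .unit := by
  have hcore : ∀ r', ∃ S, r' < r → (R.at τ₀ q).cast (.core r') = some (.insts S) := by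
    intro r'
    by_cases h : r' < r
    · obtain ⟨S, hS⟩ := (R.linv τ₀ q).core_cast r' (h.trans_le hr)
      exact ⟨S, fun _ => hS⟩
    · exact ⟨∅, fun h' => absurd h' h⟩
  choose S hS using hcore
  have hacc : ∀ᶠ τ in atTop, ∀ r' ∈ Finset.range r,
      (R.at τ p).accepted q (.core r') = some (.insts (S r')) := by
    rw [Filter.eventually_all_finset]
    exact fun r' hr' => hF.accepts_of_cast hn hq (hS r' (Finset.mem_range.1 hr')) p hp
  have hpoly : ∀ᶠ τ in atTop, ∀ r' ∈ Finset.range r, ∀ J ∈ S r', ∃ M, (R.at τ p).HasCand J M ∧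
      (i ∈ M → ∃ f, (R.at τ p).HasPoly J i f) ∧ (j ∈ M → ∃ f, (R.at τ p).HasPoly J j f) := by
    simp only [Filter.eventually_all_finset]
    intro r' hr' J hJ
    obtain ⟨M, hM, -, -, hrev⟩ := hF.core_revealed hn hq (hS r' (Finset.mem_range.1 hr')) hJ
    have hone : ∀ i, R.Correct i → ∀ᶠ τ in atTop, i ∈ M → ∃ f, (R.at τ p).HasPoly J i f := by
      intro i hi
      by_cases hiM : i ∈ M
      · obtain ⟨f, hf⟩ := hrev i hiM hi
        exact (hf p hp).mono fun τ h _ => ⟨f, h⟩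
      · exact Eventually.of_forall fun τ h => absurd h hiM
    filter_upwards [hF.hasCand hn hM hp, hone i hi, hone j hj] with τ h1 h2 h3
    exact ⟨M, h1, h2, h3⟩
  have hdone : ∀ᶠ τ in atTop, (R.at τ p).cast (.checked r q s(i, j)) ≠ none := by
    refine hF.does hp (.certify r q i j) (stable_ne fun _ _ h => h.cast _)
      (fun L _ => by simp [Rule.run, Local.acast]) ?_
    filter_upwards [hacc, hpoly] with τ h1 h2
    by_cases hd : (R.at τ p).cast (.checked r q s(i, j)) = none
    · refine Or.inl ⟨hd, fun r' hr' => ⟨S r', h1 r' (Finset.mem_range.2 hr')⟩, ?_, ?_⟩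
      · rintro J hJr ⟨S', hS', hJ⟩
        have := h1 J.round (Finset.mem_range.2 hJr)
        rw [hS'] at this
        cases this
        exact h2 J.round (Finset.mem_range.2 hJr) J hJ
      -- A pair of two correct processes is never inferred, so it cannot be in `FP`.
      · rintro ⟨J, hJ⟩
        exact (R.inv τ).not_infers hn (hi τ) (hj τ) hJ
    · exact Or.inr hd
  obtain ⟨τ, hτ⟩ := hdone.exists
  obtain ⟨v, hv⟩ := Option.ne_none_iff_exists'.1 hτ
  have := ((R.linv τ p).cast _ _ hv).1
  subst this
  exact hF.accepts_of_cast hn hp hv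

lemma GInv.row_of_dealt {sec : Inst n → K} {σ : State n t K} (h : GInv sec σ) {I : Inst n}
    (hd : I.dealer ∉ σ.corrupted) {k : Fin n} {f} (hf : (σ.loc k).row I = some f) :
    ∃ F, (σ.loc I.dealer).dealt I = some F ∧ f = F.slice (pt K k) :=
  (h.sound _ (h.rcvd _ _ _ ((h.loc k).row I f hf)) hd).2

/-- If some correct process completes, `termination2` applies. Otherwise all correct processes
participate forever, hold slices of the dealt polynomial, and confirm and certify one another until
the dealer can announce a candidate set. -/
lemma termination1 (hn : 3 * t < n) (I : Inst n) : Termination1 n t K I := by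
  rintro R hF hd ⟨τ₀, h₀⟩ hS
  by_cases hc : ∃ k, R.Correct k ∧ R.CompletesS I k
  · exact fun k hk => termination2 hn I R hF hc k hk (hS k hk)
  have hp : ∀ k, R.Correct k → ∀ᶠ τ in atTop, (R.at τ k).PartS I := by
    intro k hk
    obtain ⟨τ, hτ⟩ := hS k hk
    exact eventually_atTop.2 ⟨τ, fun τ' h => (hτ τ' h).resolve_right fun h' => hc ⟨k, hk, τ', h'⟩⟩
  obtain ⟨F, hF₀⟩ := Option.ne_none_iff_exists'.1 h₀
  have hrow : ∀ k, R.Correct k → ∀ᶠ τ in atTop, (R.at τ k).row I = some (F.slice (pt K k)) := by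
    intro k hk
    filter_upwards [hF.receives (((R.inv τ₀).out I.dealer k).1 I F hF₀) hk,
      eventually_ge_atTop τ₀] with τ h1 h2
    obtain ⟨f, hf⟩ := Option.ne_none_iff_exists'.1 ((R.linv τ k).row_ne I _ h1)
    obtain ⟨F', h3, rfl⟩ := (R.inv τ).row_of_dealt (hd τ) hf
    have h4 := (R.at_le h2 I.dealer).dealt _ _ hF₀
    have h5 : F' = F := Option.some_injective _ (h3.symm.trans h4)
    rw [← h5]
    exact hf
  have hshare : ∀ i k, R.Correct i → R.Correct k →
      ∀ᶠ τ in atTop, (i, .share I (F.eval (pt K i) (pt K k))) ∈ (R.at τ k).rcvd := by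
    intro i k hi hk
    have hdone : ∀ᶠ τ in atTop, I ∈ (R.at τ i).shared := by
      refine hF.does hi (.share I) (fun _ _ h => h.shared I) (fun L hL => ?_) ?_
      · obtain ⟨f, hf⟩ := Option.ne_none_iff_exists'.1 hL.2.2
        simp [Rule.run, hf]
      · filter_upwards [hp i hi, hrow i hi] with τ h1 h2
        by_cases hd : I ∈ (R.at τ i).shared
        · exact Or.inr hd
        · exact Or.inl ⟨Or.inl h1, hd, by simp [h2]⟩
    obtain ⟨τ, h1, h2⟩ := (hdone.and (hrow i hi)).exists
    have := hF.receives (((R.inv τ).out i k).2.1 I _ h1 h2) hk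
    simpa [SPoly.slice_eval] using this
  have hequal : ∀ k i, R.Correct k → R.Correct i → R.Accepts k (.equal I i) .unit := by
    intro k i hk hi
    have hdone : ∀ᶠ τ in atTop, (R.at τ k).cast (.equal I i) ≠ none := by
      refine hF.does hk (.equal I i) (stable_ne fun _ _ h => h.cast _)
        (fun L _ => by simp [Rule.run, Local.acast]) ?_
      filter_upwards [hp k hk, hrow k hk, hshare i k hi hk] with τ h1 h2 h3
      by_cases hd : (R.at τ k).cast (.equal I i) = none
      · exact Or.inl ⟨Or.inl h1, hd, _, _, h2, h3, by rw [SPoly.slice_eval, SPoly.eval_comm]⟩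
      · exact Or.inr hd
    obtain ⟨τ, hτ⟩ := hdone.exists
    obtain ⟨v, hv⟩ := Option.ne_none_iff_exists'.1 hτ
    have := ((R.linv τ k).cast _ _ hv).1
    subst this
    exact hF.accepts_of_cast hn hk hv
  obtain ⟨M, hMg, hMc⟩ := Finset.exists_subset_card_eq R.card_good
  have hMg' : ∀ i ∈ M, R.Correct i := fun i hi => R.mem_good.1 (hMg hi)
  have hGood : ∀ᶠ τ in atTop, (R.at τ I.dealer).GoodCand I M := by
    have h1 : ∀ᶠ τ in atTop, ∀ i ∈ M, ∀ j ∈ M,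
        (R.at τ I.dealer).accepted i (.equal I j) = some .unit := by
      simp only [Filter.eventually_all_finset]
      exact fun i hi j hj => hequal i j (hMg' i hi) (hMg' j hj) _ hd
    have h2 : ∀ᶠ τ in atTop, ∀ i ∈ M, ∀ j ∈ M, ∀ p ∈ M, ∀ q ∈ M,
        (R.at τ I.dealer).accepted p (.checked I.round q s(i, j)) = some .unit := by
      simp only [Filter.eventually_all_finset]
      intro i hi j hj p hp' q hq
      -- Participation puts `q` in the round of `I`, so `q` has A-Cast its core sets of all earlier
      -- rounds.
      obtain ⟨τ, hτ⟩ := (hp q (hMg' q hq)).exists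
      exact hF.certifies hn (hMg' p hp') (hMg' q hq) (hMg' i hi) (hMg' j hj) hτ.2.ge _ hd
    filter_upwards [h1, h2] with τ h1 h2
    exact ⟨hMc, h1, h2⟩
  have hcand : ∀ᶠ τ in atTop, (R.at τ I.dealer).cast (.cand I) ≠ none := by
    refine hF.does hd (.candidate I M) (stable_ne fun _ _ h => h.cast _)
      (fun L _ => by simp [Rule.run, Local.acast]) ?_
    filter_upwards [hp _ hd, hGood, eventually_ge_atTop τ₀] with τ h1 h2 h3
    by_cases hc : (R.at τ I.dealer).cast (.cand I) = none
    · refine Or.inl ⟨Or.inl h1, hc, rfl, ?_, h2⟩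
      rw [(R.at_le h3 I.dealer).dealt _ _ hF₀]
      simp
    · exact Or.inr hc
  obtain ⟨τ₁, h₁⟩ := hcand.exists
  obtain ⟨v, hv⟩ := Option.ne_none_iff_exists'.1 h₁
  -- The dealer may have announced a set other than `M`, but it checked that set before announcing
  -- it.
  obtain ⟨-, -, M', rfl, hG'⟩ := (R.linv τ₁ I.dealer).cast _ _ hv
  obtain ⟨τ₂, h₂⟩ := (hF.accepts_of_cast hn hd hv I.dealer hd).exists
  exact fun k hk => (hF.completesS_of_cand hn h₂ hG' hk (hS k hk).eventually).exists

end Termination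

/-! ### Correctness -/

section Counting

variable {n t : ℕ} {K : Type} [Field K]

/-- A member of an interpolation set for `f` contradicts one of more than `t` processes with
polynomials from `F`, if `f` and `F` have different constant coefficients. -/
lemma exists_conflict (hv : Function.Injective (pt K : Fin n → K)) {f F : SPoly t K}
    (hne : f.eval 0 0 ≠ F.eval 0 0) {A C : Finset (Fin n)} (hA : t < A.card) (hC : t < C.card) :
    ∃ i ∈ A, ∃ j ∈ C, (f.slice (pt K i)).eval (pt K j) ≠ (F.slice (pt K j)).eval (pt K i) := by
  -- Without a conflict, for each `j` in `C` the slices of `f` and `F` at `j` agree at the more than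
  -- `t` points of `A`, so `f` and `F` share more than `t` slices.
  by_contra! hc
  refine hne (SPoly.eval_zero_eq_of_slice hv hC fun j hj => UPoly.ext_of_eval hv hA fun i hi => ?_)
  rw [← hc i hi j hj, SPoly.slice_eval, SPoly.slice_eval, SPoly.eval_comm]

/-- The pairs in `M` whose polynomials are inconsistent. -/
def conflicts (M : Finset (Fin n)) (g : Fin n → UPoly t K) : Finset (Sym2 (Fin n)) :=
  Finset.univ.filter fun e => ∃ i ∈ M, ∃ j ∈ M, e = s(i, j) ∧ (g i).eval (pt K j) ≠ (g j).eval (pt K i)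

/-- Let `B` be the members whose polynomial is a slice of `f`. A member outside `B` agrees with at
most `t` members of `B`, since otherwise its polynomial would be a slice of `f`. So there are at
least `(n - t - |B|)(|B| - t)` conflicts. This is concave in `|B|`, and at both ends of the range `n
- 2t ≤ |B| ≤ 2t` it equals `t(n - 3t)`. -/
lemma card_conflicts (hn : 3 * t < n) (hv : Function.Injective (pt K : Fin n → K)) {f F : SPoly t K}
    (hne : f.eval 0 0 ≠ F.eval 0 0) {M A C : Finset (Fin n)} (hM : M.card = n - t) (hA : A ⊆ M)
    (hC : C ⊆ M) (hAc : n - 2 * t ≤ A.card) (hCc : n - 2 * t ≤ C.card) {g : Fin n → UPoly t K}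
    (hgA : ∀ i ∈ A, g i = f.slice (pt K i)) (hgC : ∀ i ∈ C, g i = F.slice (pt K i)) :
    t * (n - 3 * t) ≤ (conflicts M g).card := by
  let B := M.filter fun i => g i = f.slice (pt K i)
  have hBM : B ⊆ M := Finset.filter_subset _ _
  have hgB : ∀ i ∈ B, g i = f.slice (pt K i) := fun i hi => (Finset.mem_filter.1 hi).2
  have hB1 : n - 2 * t ≤ B.card :=
    hAc.trans (Finset.card_le_card fun i hi => Finset.mem_filter.2 ⟨hA hi, hgA i hi⟩)
  have hB2 : B.card ≤ 2 * t := by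
    -- More than `t` common members would give `f` and `F` the same constant coefficient.
    have h1 : (B ∩ C).card ≤ t := by
      by_contra! hc
      refine hne (SPoly.eval_zero_eq_of_slice hv hc fun i hi => ?_)
      rw [Finset.mem_inter] at hi
      rw [← hgB i hi.1, hgC i hi.2]
    have h2 := Finset.card_union_add_card_inter B C
    have h3 := Finset.card_le_card (Finset.union_subset hBM hC)
    omega
  -- The first entry lies outside `B` and the second inside, so no unordered pair is counted twice.
  let D := (M \ B).sigma fun i => B.filter fun j => (g i).eval (pt K j) ≠ (g j).eval (pt K i)
  have hD1 : (n - t - B.card) * (B.card - t) ≤ D.card := by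
    rw [Finset.card_sigma, ← hM, ← Finset.card_sdiff_of_subset hBM, ← smul_eq_mul]
    refine Finset.card_nsmul_le_sum _ _ _ fun i hi => ?_
    rw [Finset.mem_sdiff] at hi
    have h1 : (B.filter fun j => (g i).eval (pt K j) = (g j).eval (pt K i)).card ≤ t := by
      by_contra! hc
      refine hi.2 (Finset.mem_filter.2 ⟨hi.1, UPoly.ext_of_eval hv hc fun j hj => ?_⟩)
      rw [Finset.mem_filter] at hj
      rw [hj.2, hgB j hj.1, SPoly.slice_eval, SPoly.slice_eval, SPoly.eval_comm]
    have h2 := Finset.card_filter_add_card_filter_not (s := B)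
      (fun j => (g i).eval (pt K j) = (g j).eval (pt K i))
    have h3 : (B.filter fun j => ¬ (g i).eval (pt K j) = (g j).eval (pt K i)).card =
      (B.filter fun j => (g i).eval (pt K j) ≠ (g j).eval (pt K i)).card := rfl
    omega
  have hD2 : D.card ≤ (conflicts M g).card := by
    refine Finset.card_le_card_of_injOn (fun x => s(x.1, x.2)) ?_ ?_
    · rintro ⟨i, j⟩ hx
      simp only [D, Finset.coe_sigma, Set.mem_sigma_iff, Finset.mem_coe, Finset.mem_sdiff,
        Finset.mem_filter] at hx
      simp only [conflicts, Finset.coe_filter, Finset.mem_univ, true_and, Set.mem_ofPred_eq]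
      exact ⟨i, hx.1.1, j, hBM hx.2.1, rfl, hx.2.2⟩
    · rintro ⟨i, j⟩ hx ⟨i', j'⟩ hx' he
      simp only [D, Finset.coe_sigma, Set.mem_sigma_iff, Finset.mem_coe, Finset.mem_sdiff,
        Finset.mem_filter (s := B)] at hx hx'
      rcases Sym2.eq_iff.1 he with ⟨h1, h2⟩ | ⟨h1, h2⟩
      · simp only at h1 h2
        subst h1 h2
        rfl
      · simp only at h1 h2
        subst h1 h2
        exact absurd hx'.2.1 hx.1.2
  refine le_trans ?_ (hD1.trans hD2)
  -- With `|B| = (n - 2t) + y = 2t - z`, the product exceeds `t(n - 3t)` by exactly `yz`.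
  obtain ⟨y, hy⟩ := Nat.exists_eq_add_of_le hB1
  obtain ⟨z, hz⟩ := Nat.exists_eq_add_of_le hB2
  obtain ⟨m, rfl⟩ := Nat.exists_eq_add_of_lt hn
  have e1 : 3 * t + m + 1 - 3 * t = m + 1 := by omega
  have e2 : 3 * t + m + 1 - t - B.card = t - y := by omega
  have e3 : B.card - t = m + 1 + y := by omega
  obtain ⟨w, hw⟩ : ∃ w, t = y + w := ⟨t - y, by omega⟩
  rw [e1, e2, e3, hw, Nat.add_sub_cancel_left]
  have hwm : m + 1 + z = w := by omega
  rw [← hwm]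
  nlinarith [Nat.zero_le (y * z)]

end Counting

/-! ### The committed value and the inference of new faulty pairs. -/

section Correct

variable {n t : ℕ} {K : Type} [Field K] {R : Run n t K}

/-- Pairs of members of a candidate set have not been inferred from earlier instances. -/
lemma Run.newPair (hn : 3 * t < n) {I : Inst n} {τ₀ : ℕ} {k₀ : Fin n} {M : Finset (Fin n)}
    (hG : (R.at τ₀ k₀).GoodCand I M) {i j : Fin n} (hi : i ∈ M) (hj : j ∈ M) :
    R.NewPair I s(i, j) := by
  rintro J hJ ⟨m, -, τm, hout⟩ k - τ ⟨-, M₁, hM₁, i₁, hi₁, j₁, hj₁, f₁, g₁, he₁, hf₁, hg₁, hne⟩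
  obtain ⟨x, hx⟩ := Option.ne_none_iff_exists'.1 hout
  have hready := ((R.linv τm m).output J x hx).2
  -- At least `n - 2t` correct processes were ready in `J`, and `(n - t) + (n - 2t) > n`, so one of
  -- them lies in `M`.
  obtain ⟨q, hq⟩ : (M ∩ ((R.at τm m).readySet J ∩ R.good)).Nonempty := by
    rw [← Finset.card_pos]
    have h1 := R.card_inter_good hready
    have h2 := hG.1
    have h3 := Finset.card_union_add_card_inter M ((R.at τm m).readySet J ∩ R.good)
    have h4 := Finset.card_le_univ (M ∪ ((R.at τm m).readySet J ∩ R.good))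
    rw [Fintype.card_fin] at h4
    omega
  simp only [Finset.mem_inter, R.mem_good, Local.readySet, Finset.mem_filter, Finset.mem_univ,
    true_and] at hq
  obtain ⟨hqM, hqr, hqc⟩ := hq
  obtain ⟨-, y, hy⟩ := (R.linv τm q).cast _ _ (R.cast_of_accepted hn hqc hqr)
  -- Here `q` certifies the pair against its own core sets, so both certifier and reporter are
  -- correct.
  obtain ⟨-, i₂, j₂, he₂, hcert⟩ := (R.linv τ₀ q).cast _ _
    (R.cast_of_accepted hn hqc (hG.2.2 i hi j hj q hqM q hqM))
  obtain ⟨S, hS, hcons⟩ := hcert J.round hJ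
  have hScast := R.cast_of_accepted hn hqc hS
  -- The core set of the round of `J` is A-Cast only after that round, and no value is set for `J`
  -- later; so the set contains `J`.
  have hJS : J ∈ S := by
    have hround := ((R.linv τ₀ q).cast _ _ hScast).1
    have hle := R.at_le (le_max_left τ₀ τm) q
    obtain ⟨S', hS', hJ'⟩ := ((R.linv (max τ₀ τm) q).value_core J y
      ((R.at_le (le_max_right τ₀ τm) q).value _ _ hy)).2 (hround.trans_le hle.round)
    have := hle.cast _ _ hScast
    rw [hS'] at this
    cases this
    exact hJ'
  obtain ⟨M₂, hM₂, h₂⟩ := hcons J hJS rfl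
  have hMM : M₁ = M₂ := by
    have := R.accepted_unique hn hM₁ hM₂
    cases this
    rfl
  subst hMM
  have huniq : ∀ {i f g}, (R.at τ k).HasPoly J i f → (R.at τ₀ q).HasPoly J i g → f = g := by
    intro i f g hf hg
    have := R.accepted_unique hn hf hg
    cases this
    rfl
  rw [he₁, Sym2.eq_iff] at he₂
  rcases he₂ with ⟨rfl, rfl⟩ | ⟨rfl, rfl⟩
  · obtain ⟨f₂, g₂, hf₂, hg₂, heq⟩ := h₂ hi₁ hj₁
    rw [huniq hf₁ hf₂, huniq hg₁ hg₂] at hne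
    exact hne heq
  · obtain ⟨g₂, f₂, hg₂, hf₂, heq⟩ := h₂ hj₁ hi₁
    rw [huniq hf₁ hf₂, huniq hg₁ hg₂] at hne
    exact hne heq.symm

/-- A correct dealer announced `M`, so it has dealt a polynomial with the right constant
coefficient. That polynomial and `F` have the slices of more than `t` correct members in common. -/
lemma Run.eval_zero_eq_secret (hK : Set.InjOn (fun m : ℕ => (m : K)) (Set.Iic n)) (hn : 3 * t < n)
    {I : Inst n} {τ₀ : ℕ} {k₀ : Fin n} {M : Finset (Fin n)} (hM : (R.at τ₀ k₀).HasCand I M)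
    (hG : (R.at τ₀ k₀).GoodCand I M) {F : SPoly t K}
    (hrow : ∀ i ∈ M, R.Correct i → (R.at τ₀ i).row I = some (F.slice (pt K i)))
    (hd : R.Correct I.dealer) : F.eval 0 0 = R.secret I := by
  obtain ⟨-, ⟨F', hF'⟩, -⟩ := (R.linv τ₀ I.dealer).cast _ _ (R.cast_of_accepted hn hd hM)
  rw [← ((R.linv τ₀ I.dealer).dealt I F' hF').2, ← F'.eval_zero]
  have hc : t < (M ∩ R.good).card := by
    have := R.card_inter_good hG.1.ge
    omega
  refine SPoly.eval_zero_eq_of_slice (pt_injective (n := n) hK) hc fun i hi => ?_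
  rw [Finset.mem_inter, R.mem_good] at hi
  obtain ⟨F'', h1, h2⟩ := (R.inv τ₀).row_of_dealt (hd τ₀) (hrow i hi.1 hi.2)
  have h3 : F'' = F' := Option.some_injective _ (h1.symm.trans hF')
  rw [h2, h3]

/-- The process `k` with the deviating output reports `I` after the round, which lets all correct
processes infer from `I` and makes the correct members of `M` reveal. The conflicts lie between
slices of the interpolant `f` and slices of `F`. -/
lemma Run.Fair.infersNewPairs (hK : Set.InjOn (fun m : ℕ => (m : K)) (Set.Iic n)) (hn : 3 * t < n)
    (hF : R.Fair) {I : Inst n} {τ₀ : ℕ} {k₀ : Fin n} {M : Finset (Fin n)}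
    (hM : (R.at τ₀ k₀).HasCand I M) (hG : (R.at τ₀ k₀).GoodCand I M) {F : SPoly t K}
    (hrow : ∀ i ∈ M, R.Correct i → (R.at τ₀ i).row I = some (F.slice (pt K i)))
    (hend : R.RoundEnds I) {k : Fin n} (hk : R.Correct k) {τ : ℕ} {w : K}
    (hout : (R.at τ k).output I = some w) (hw : w ≠ F.eval 0 0) : R.InfersNewPairs I := by
  have hinj := pt_injective (n := n) hK
  have hval := ((R.linv τ k).output I w hout).1
  obtain ⟨-, -, -, IS, f, M', rfl, hM', hIS, hISc, hpoly⟩ := (R.linv τ k).value I w hval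
  have hMM : M' = M := by
    have := R.accepted_unique hn hM' hM
    cases this
    rfl
  subst hMM
  -- all correct processes report `I`, and the correct members of the candidate set reveal
  obtain ⟨τ₁, hτ₁⟩ := hend k hk
  obtain ⟨S, hS, hIS'⟩ := ((R.linv (max τ τ₁) k).value_core I _
    ((R.at_le (le_max_left τ τ₁) k).value _ _ hval)).2
    (hτ₁.trans_le (R.at_le (le_max_right τ τ₁) k).round)
  obtain ⟨M₂, hM₂, -, hrep, hrev⟩ := hF.core_revealed hn hk hS hIS'
  have hMM : M₂ = M' := by
    have := R.accepted_unique hn hM₂ hM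
    cases this
    rfl
  subst hMM
  -- Receipt by `k` at any time suffices, since totality passes the polynomial on to all correct
  -- processes.
  let Rev : Fin n → UPoly t K → Prop := fun i g => ∃ τ, (R.at τ k).HasPoly I i g
  have hRev_uniq : ∀ {i g g'}, Rev i g → Rev i g' → g = g' := by
    rintro i g g' ⟨τ, h⟩ ⟨τ', h'⟩
    have := R.accepted_unique hn h h'
    cases this
    rfl
  have hRevIS : ∀ i ∈ IS, Rev i (f.slice (pt K i)) := by
    intro i hi
    obtain ⟨fi, h1, h2⟩ := hpoly i hi
    -- Interpolation compares values only at points of `M`; these are more than `t`, so the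
    -- polynomials coincide.
    have : f.slice (pt K i) = fi := UPoly.ext_of_eval hinj (s := M₂) (by have := hG.1; omega)
      fun j hj => by rw [SPoly.slice_eval, h2 j hj]
    exact ⟨τ, this ▸ h1⟩
  have hRevC : ∀ i ∈ M₂ ∩ R.good, Rev i (F.slice (pt K i)) := by
    intro i hi
    rw [Finset.mem_inter, R.mem_good] at hi
    obtain ⟨fi, h1⟩ := hrev i hi.1 hi.2
    obtain ⟨τ', h2, h3⟩ := ((h1 k hk).and (eventually_ge_atTop τ₀)).exists
    have h4 := (R.inv τ').row_of_hasPoly hn (hi.2 τ') h2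
    have h5 := (R.at_le h3 i).row _ _ (hrow i hi.1 hi.2)
    have h6 : fi = F.slice (pt K i) := Option.some_injective _ (h4.symm.trans h5)
    exact ⟨τ', h6 ▸ h2⟩
  let P : Finset (Sym2 (Fin n)) := Finset.univ.filter fun e => ∃ i ∈ M₂, ∃ j ∈ M₂, ∃ gi gj,
    e = s(i, j) ∧ Rev i gi ∧ Rev j gj ∧ gi.eval (pt K j) ≠ gj.eval (pt K i)
  have hinf : ∀ e ∈ P, ∀ k', R.Correct k' → ∀ᶠ τ in atTop, (R.at τ k').Infers I e := by
    intro e he k' hk'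
    simp only [P, Finset.mem_filter, Finset.mem_univ, true_and] at he
    obtain ⟨i, hi, j, hj, gi, gj, rfl, ⟨τi, h1⟩, ⟨τj, h2⟩, h3⟩ := he
    filter_upwards [hrep k' hk', hF.hasCand hn hM hk', hF.accepts_of_accepted hn h1 k' hk',
      hF.accepts_of_accepted hn h2 k' hk'] with τ h4 h5 h6 h7
    exact ⟨h4, _, h5, i, hi, j, hj, gi, gj, rfl, h6, h7, h3⟩
  have hcC := R.card_inter_good hG.1.ge
  refine ⟨P, ?_, fun e he => ⟨?_, ?_⟩, fun k' hk' => ?_, fun hall => ?_⟩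
  · obtain ⟨i, hi, j, hj, hne⟩ := exists_conflict hinj hw (A := IS) (C := M₂ ∩ R.good)
      (by omega) (by omega)
    refine ⟨s(i, j), ?_⟩
    simp only [P, Finset.mem_filter, Finset.mem_univ, true_and]
    exact ⟨i, hIS hi, j, (Finset.mem_inter.1 hj).1, _, _, rfl, hRevIS i hi, hRevC j hj, hne⟩
  · by_contra hc
    obtain ⟨τ', hτ'⟩ := (hinf e he k hk).exists
    induction e with | _ i j
    simp only [Run.FaultyPair, Sym2.mem_iff, not_exists, not_and, not_not] at hc
    exact (R.inv τ').not_infers hn (hc i (Or.inl rfl) τ') (hc j (Or.inr rfl) τ') hτ'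
  · simp only [P, Finset.mem_filter, Finset.mem_univ, true_and] at he
    obtain ⟨i, hi, j, hj, -, -, rfl, -⟩ := he
    exact R.newPair hn hG hi hj
  · have : ∀ᶠ τ in atTop, ∀ e ∈ P, (R.at τ k').Infers I e := by
      rw [Filter.eventually_all_finset]
      exact fun e he => hinf e he k' hk'
    exact this.exists
  · have hg : ∀ i, ∃ g, i ∈ M₂ → Rev i g := by
      intro i
      by_cases hi : i ∈ M₂
      · obtain ⟨τ', g, hg⟩ := hall k hk τ M₂ hM' i hi
        exact ⟨g, fun _ => ⟨τ', hg⟩⟩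
      · exact ⟨0, fun h => absurd h hi⟩
    choose g hg using hg
    refine (card_conflicts hn hinj hw hG.1 hIS Finset.inter_subset_left hISc.ge hcC (g := g)
      (fun i hi => hRev_uniq (hg i (hIS hi)) (hRevIS i hi))
      (fun i hi => hRev_uniq (hg i (Finset.mem_inter.1 hi).1) (hRevC i hi))).trans
      (Finset.card_le_card fun e he => ?_)
    simp only [conflicts, Finset.mem_filter, Finset.mem_univ, true_and] at he
    obtain ⟨i, hi, j, hj, rfl, hne⟩ := he
    simp only [P, Finset.mem_filter, Finset.mem_univ, true_and]
    exact ⟨i, hi, j, hj, _, _, rfl, hg i hi, hg j hj, hne⟩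

/-- `F` is read off the rows stored at time `T` by the uncontrolled members of `M`. Rows are never
overwritten, and a process that is correct in a continuation is uncontrolled at `T`, so the same `F`
serves every continuation. -/
lemma correctness (hK : Set.InjOn (fun m : ℕ => (m : K)) (Set.Iic n)) (hn : 3 * t < n)
    (I : Inst n) : Correctness n t K I := by
  rintro R T ⟨k₀, -, h₀⟩
  obtain ⟨M, hM, hG⟩ := (R.linv T k₀).doneS I h₀
  obtain ⟨F, hrow⟩ := (R.inv T).exists_spoly hK hn hG
  refine ⟨F.eval 0 0, fun R' hF' hst => ?_⟩
  have hT := hst T le_rfl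
  simp only [Run.at, ← hT] at hM hG hrow
  have hrow' : ∀ i ∈ M, R'.Correct i → (R'.at T i).row I = some (F.slice (pt K i)) :=
    fun i hi hic => hrow i hi (hic T)
  refine ⟨fun hend => ?_, R'.eval_zero_eq_secret hK hn hM hG hrow'⟩
  by_cases hall : ∀ k, R'.Correct k → ∀ τ w, (R'.at τ k).output I = some w → w = F.eval 0 0
  · exact Or.inl hall
  · push Not at hall
    obtain ⟨k, hk, τ, w, hout, hw⟩ := hall
    exact Or.inr (hF'.infersNewPairs hK hn hM hG hrow' hend hk hout hw)

end Correct

/-! ### Secrecy -/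

section Shift

variable {n t : ℕ} {K : Type} [Field K]

lemma UPoly.eval_add (f g : UPoly t K) (x : K) : (f + g).eval x = f.eval x + g.eval x := by
  simp [eval, add_mul, Finset.sum_add_distrib]

lemma SPoly.slice_add (f g : SPoly t K) (x : K) : (f + g).slice x = f.slice x + g.slice x := by
  funext q
  simp [slice, add_mul, Finset.sum_add_distrib]

lemma SPoly.eval_of_slice_eq_zero {D : SPoly t K} {x : K} (h : D.slice x = 0) (y : K) :
    D.eval x y = 0 := by
  rw [← slice_eval, h]
  simp [UPoly.eval]

variable (D : SPoly t K) (I : Inst n)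

/-- The effect on a message of adding `D` to the polynomial of the dealer of `I`. -/
def Msg.shift (src dst : Fin n) : Msg n t K → Msg n t K
  | .row J f => .row J (if J = I ∧ src = I.dealer then f + D.slice (pt K dst) else f)
  | .share J x => .share J (if J = I then x + D.eval (pt K src) (pt K dst) else x)
  | m => m

/-- The effect on a packet of adding `D` to the polynomial of the dealer of `I`. -/
def Packet.shift (p : Packet n t K) : Packet n t K := ⟨p.src, p.dst, p.msg.shift D I p.src p.dst⟩

/-- The effect on the memory of process `k` of adding `D` to the polynomial of the dealer of `I`. -/
def Local.shift (k : Fin n) (L : Local n t K) : Local n t K :=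
  { L with
    rcvd := (fun x => (x.1, x.2.shift D I x.1 k)) '' L.rcvd
    dealt := fun J => if J = I then (L.dealt J).map (· + D) else L.dealt J
    row := fun J => if J = I then (L.row J).map (· + D.slice (pt K k)) else L.row J }

/-- The effect on a state of adding `D` to the polynomial of the dealer of `I`. -/
def State.shift (σ : State n t K) : State n t K where
  corrupted := σ.corrupted
  loc := fun k => (σ.loc k).shift D I k
  net := σ.net.map (Packet.shift D I)

lemma Local.shift_start (k : Fin n) : (Local.start n t K).shift D I k = Local.start n t K := by
  simp [Local.shift, Local.start]

lemma State.shift_start : (State.start n t K).shift D I = State.start n t K := by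
  simp [State.shift, State.start, Local.shift_start]

variable {D I} {k : Fin n} {L : Local n t K}

lemma Local.shift_mem_acMsg {s o : Fin n} {g v} :
    (s, .acMsg o g v) ∈ (L.shift D I k).rcvd ↔ (s, .acMsg o g v) ∈ L.rcvd := by
  simp only [shift, Set.mem_image, Prod.mk.injEq, Prod.exists]
  constructor
  · rintro ⟨s', m, hm, rfl, h⟩
    cases m <;> simp_all [Msg.shift]
  · exact fun h => ⟨s, _, h, rfl, rfl⟩

lemma Local.shift_mem_acEcho {s o : Fin n} {g v} :
    (s, .acEcho o g v) ∈ (L.shift D I k).rcvd ↔ (s, .acEcho o g v) ∈ L.rcvd := by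
  simp only [shift, Set.mem_image, Prod.mk.injEq, Prod.exists]
  constructor
  · rintro ⟨s', m, hm, rfl, h⟩
    cases m <;> simp_all [Msg.shift]
  · exact fun h => ⟨s, _, h, rfl, rfl⟩

lemma Local.shift_mem_acReady {s o : Fin n} {g v} :
    (s, .acReady o g v) ∈ (L.shift D I k).rcvd ↔ (s, .acReady o g v) ∈ L.rcvd := by
  simp only [shift, Set.mem_image, Prod.mk.injEq, Prod.exists]
  constructor
  · rintro ⟨s', m, hm, rfl, h⟩
    cases m <;> simp_all [Msg.shift]
  · exact fun h => ⟨s, _, h, rfl, rfl⟩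

lemma Local.shift_mem_share {s : Fin n} {J : Inst n} {x : K} :
    (s, .share J (if J = I then x + D.eval (pt K s) (pt K k) else x)) ∈ (L.shift D I k).rcvd ↔
      (s, .share J x) ∈ L.rcvd := by
  simp only [shift, Set.mem_image, Prod.mk.injEq, Prod.exists]
  constructor
  · rintro ⟨s', m, hm, rfl, h⟩
    cases m with
    | share J' x' =>
      simp only [Msg.shift, Msg.share.injEq] at h
      obtain ⟨rfl, h⟩ := h
      split_ifs at h with hJ
      · rwa [add_right_cancel h] at hm
      · rwa [h] at hm
    | _ => simp [Msg.shift] at h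
  · exact fun h => ⟨s, _, h, rfl, rfl⟩

lemma Local.shift_count_acEcho {o : Fin n} {g v} :
    (L.shift D I k).count (.acEcho o g v) = L.count (.acEcho o g v) := by
  simp only [count, shift_mem_acEcho]

lemma Local.shift_count_acReady {o : Fin n} {g v} :
    (L.shift D I k).count (.acReady o g v) = L.count (.acReady o g v) := by
  simp only [count, shift_mem_acReady]

lemma Local.shift_row_eq_none {J : Inst n} : (L.shift D I k).row J = none ↔ L.row J = none := by
  simp only [shift]
  split_ifs <;> simp

lemma Local.shift_dealt_eq_none {J : Inst n} :
    (L.shift D I k).dealt J = none ↔ L.dealt J = none := by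
  simp only [shift]
  split_ifs <;> simp

/-- Guards mention rows only through their existence, except in Step 3 of the sharing. There the
received share and the process's own value are both shifted by `D(i,k) = D(k,i)`. -/
lemma Rule.guard_shift (ρ : Rule n t K) : ρ.Guard k (L.shift D I k) ↔ ρ.Guard k L := by
  cases ρ with
  | echo o g v => simp only [Guard, Local.shift_mem_acMsg]; rfl
  | ready o g v =>
    simp only [Guard, Local.shift_count_acEcho, Local.shift_count_acReady]; rfl
  | accept o g v => simp only [Guard, Local.shift_count_acReady]; rfl
  | share J => simp only [Guard, ne_eq, Local.shift_row_eq_none]; rfl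
  | equal J i =>
    refine and_congr Iff.rfl (and_congr Iff.rfl ?_)
    by_cases hJ : J = I
    · subst hJ
      constructor
      · rintro ⟨f, x, hf, hx, he⟩
        simp only [Local.shift, if_true, Option.map_eq_some_iff] at hf
        obtain ⟨f', hf', rfl⟩ := hf
        have h2 : (i, .share J (x - D.eval (pt K i) (pt K k))) ∈ L.rcvd := by
          rw [← Local.shift_mem_share (D := D) (I := J) (k := k)]
          simpa using hx
        refine ⟨f', _, hf', h2, ?_⟩
        rw [UPoly.eval_add, SPoly.slice_eval, SPoly.eval_comm] at he
        rw [← he, add_sub_cancel_right]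
      · rintro ⟨f, x, hf, hx, he⟩
        refine ⟨f + D.slice (pt K k), _, ?_, Local.shift_mem_share.2 hx, ?_⟩
        · simp [Local.shift, hf]
        · rw [if_pos rfl, UPoly.eval_add, SPoly.slice_eval, SPoly.eval_comm, he]
    · have h1 : (L.shift D I k).row J = L.row J := by simp [Local.shift, hJ]
      have h2 : ∀ x, (i, .share J x) ∈ (L.shift D I k).rcvd ↔ (i, .share J x) ∈ L.rcvd := by
        intro x
        have := Local.shift_mem_share (D := D) (I := I) (k := k) (L := L) (s := i) (J := J) (x := x)
        rwa [if_neg hJ] at this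
      simp only [h1, h2]
  | candidate J M => simp only [Guard, ne_eq, Local.shift_dealt_eq_none]; rfl
  | completeS J => exact Iff.rfl
  | reveal J => simp only [Guard, ne_eq, Local.shift_row_eq_none]; rfl
  | interpolate J IS f => exact Iff.rfl
  | finish J => exact Iff.rfl
  | certify r l i j => exact Iff.rfl

lemma Call.guard_shift (c : Call n) : c.Guard k (L.shift D I k) ↔ c.Guard k L := by
  cases c with
  | deal J => simp only [Guard, Local.shift_dealt_eq_none]; rfl
  | _ => exact Iff.rfl

lemma map_shift_toAll {k : Fin n} {m : Msg n t K} (h : ∀ i j, m.shift D I i j = m) :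
    (toAll k m).map (Packet.shift D I) = toAll k m := by
  simp [toAll, Packet.shift, h, Function.comp_def]

/-- The shares computed from a shifted row are the shifted shares. Only `reveal` publishes the row
under a heading that is not shifted, so there the slice of `D` must vanish. -/
lemma Rule.run_shift (ρ : Rule n t K) (hg : ρ.Guard k L)
    (hr : ρ = .reveal I → D.slice (pt K k) = 0) :
    ρ.run k (L.shift D I k) =
      ((ρ.run k L).1.shift D I k, (ρ.run k L).2.map (Packet.shift D I)) := by
  cases ρ with
  | share J =>
    obtain ⟨f, hf⟩ := Option.ne_none_iff_exists'.1 hg.2.2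
    by_cases hJ : J = I
    · subst hJ
      have h1 : (L.shift D J k).row J = some (f + D.slice (pt K k)) := by simp [Local.shift, hf]
      simp only [run, h1, hf]
      simp [Packet.shift, Msg.shift, Function.comp_def, UPoly.eval_add, SPoly.slice_eval,
        Local.shift]
    · have h1 : (L.shift D I k).row J = some f := by simp [Local.shift, hf, hJ]
      simp only [run, h1, hf]
      simp [Packet.shift, Msg.shift, Function.comp_def, hJ, Local.shift]
  | reveal J =>
    obtain ⟨f, hf⟩ := Option.ne_none_iff_exists'.1 hg.2.2.2.1
    have h1 : (L.shift D I k).row J = some f := by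
      by_cases hJ : J = I
      · subst hJ
        simp [Local.shift, hf, hr rfl]
      · simp [Local.shift, hf, hJ]
    simp only [run, h1, hf, Local.acast]
    rw [map_shift_toAll fun _ _ => rfl]
    rfl
  | accept o g v => rfl
  | completeS J => rfl
  | finish J => rfl
  | _ =>
    simp only [run, Local.acast]
    rw [map_shift_toAll fun _ _ => rfl]
    rfl

lemma SPoly.withSecret_add {a D : SPoly t K} {s s' : K} (h : s' = s + D s(0, 0)) :
    (a + D).withSecret s' = a.withSecret s + D := by
  funext e
  by_cases he : e = s(0, 0)
  · subst he
    simp [withSecret, h]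
  · simp [withSecret, Function.update_of_ne he]

/-- The change of secret is absorbed by `D(0,0)`: dealing with coin `a + D` and the new secret
yields the old polynomial plus `D`. -/
lemma Call.run_shift {sec sec' : Inst n → K} (hsec : ∀ J, J ≠ I → sec J = sec' J)
    (hI : sec' I = sec I + D s(0, 0)) (a : SPoly t K) (c : Call n) (hg : c.Guard k L) :
    c.run sec' (if c = .deal I then a + D else a) k (L.shift D I k) =
      ((c.run sec a k L).1.shift D I k, (c.run sec a k L).2.map (Packet.shift D I)) := by
  cases c with
  | nextRound =>
    simp only [run, Local.acast]
    rw [map_shift_toAll fun _ _ => rfl]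
    rfl
  | deal J =>
    by_cases hJ : J = I
    · subst hJ
      have hk : k = J.dealer := hg.1
      simp only [run, if_true, SPoly.withSecret_add hI, Prod.mk.injEq]
      constructor
      · simp only [Local.shift]
        congr 1
        funext J'
        by_cases hJ' : J' = J
        · subst hJ'
          simp
        · simp [hJ']
      · simp [Packet.shift, Msg.shift, Function.comp_def, hk, SPoly.slice_add]
    · have hne : (Call.deal J : Call n) ≠ .deal I := fun h => hJ (by cases h; rfl)
      simp only [run, if_neg hne, ← hsec J hJ, Prod.mk.injEq]
      constructor
      · simp only [Local.shift]
        congr 1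
        funext J'
        by_cases hJ' : J' = J
        · subst hJ'
          simp [hJ]
        · simp [hJ']
      · simp [Packet.shift, Msg.shift, Function.comp_def, hJ]
  | _ => rfl

lemma Local.receive_shift (src : Fin n) (m : Msg n t K) :
    (L.shift D I k).receive src (m.shift D I src k) = (L.receive src m).shift D I k := by
  cases m with
  | row J f =>
    by_cases hc : src = J.dealer ∧ L.row J = none
    · have hc' : src = J.dealer ∧ (L.shift D I k).row J = none :=
        ⟨hc.1, shift_row_eq_none.2 hc.2⟩
      simp only [receive, Msg.shift, if_pos hc, if_pos hc']
      simp only [shift, Set.image_insert_eq, Msg.shift]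
      congr 1
      funext J'
      by_cases hJ' : J' = J
      · subst hJ'
        by_cases hJ : J' = I
        · subst hJ
          simp [hc.1]
        · simp [hJ]
      · simp [hJ']
    · have hc' : ¬ (src = J.dealer ∧ (L.shift D I k).row J = none) := fun h =>
        hc ⟨h.1, shift_row_eq_none.1 h.2⟩
      simp only [receive, Msg.shift, if_neg hc, if_neg hc']
      simp only [shift, Set.image_insert_eq, Msg.shift]
  | _ => simp only [receive, shift, Msg.shift, Set.image_insert_eq]

/-- Used for injected packets: a row not sent by the dealer is not shifted, and a share from a
process where the slice of `D` vanishes is shifted by zero. -/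
lemma Msg.shift_eq_self {src dst : Fin n} {m : Msg n t K} (h1 : src ≠ I.dealer)
    (h2 : D.slice (pt K src) = 0) : m.shift D I src dst = m := by
  cases m <;> simp [shift, h1, SPoly.eval_of_slice_eq_zero h2]

/-- The adversary's knowledge of a controlled process is unaffected: its row changes by a zero
slice, and shares sent to it change by `D(s,k) = D(k,s) = 0`. -/
lemma Local.shift_eq_self (h1 : L.dealt I = none) (h2 : D.slice (pt K k) = 0) :
    L.shift D I k = L := by
  have hm : ∀ s (m : Msg n t K), m.shift D I s k = m := by
    intro s m
    cases m <;> simp [Msg.shift, h2, SPoly.eval_comm D _ (pt K k), SPoly.eval_of_slice_eq_zero h2]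
  have hd : (fun J => if J = I then (L.dealt J).map (· + D) else L.dealt J) = L.dealt := by
    funext J
    by_cases hJ : J = I
    · subst hJ
      simp [h1]
    · simp [hJ]
  have hr : (fun J => if J = I then (L.row J).map (· + D.slice (pt K k)) else L.row J) = L.row := by
    funext J
    simp [h2]
  simp [shift, hm, hd, hr]

lemma State.shift_local (σ : State n t K) (x : Local n t K × List (Packet n t K)) :
    (σ.local k x).shift D I =
      (σ.shift D I).local k (x.1.shift D I k, x.2.map (Packet.shift D I)) := by
  simp only [State.local, State.shift, List.map_append]
  congr 1
  funext j
  by_cases hj : j = k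
  · subst hj
    simp
  · simp [hj]

lemma Cmd.enabled_shift (σ : State n t K) (c : Cmd n t K) :
    c.Enabled (σ.shift D I) ↔ c.Enabled σ := by
  cases c with
  | corrupt i => exact Iff.rfl
  | inject p => exact Iff.rfl
  | deliver m => simp [Enabled, State.shift]
  | call k c => exact and_congr Iff.rfl (Call.guard_shift c)
  | rule k ρ => exact and_congr Iff.rfl (Rule.guard_shift ρ)

/-- Adding `D` to the polynomial of the dealer of `I` commutes with the steps of the system. -/
lemma exec_shift {sec sec' : Inst n → K} (hsec : ∀ J, J ≠ I → sec J = sec' J)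
    (hI : sec' I = sec I + D s(0, 0)) (a a' : SPoly t K) (σ : State n t K) (c : Cmd n t K)
    (hd : I.dealer ∉ σ.corrupted) (hD : ∀ i ∈ σ.corrupted, D.slice (pt K i) = 0)
    (hr : ∀ k, c = .rule k (.reveal I) → c.Enabled σ → D.slice (pt K k) = 0)
    (ha : a' = if (∃ k, c = .call k (.deal I)) ∧ c.Enabled σ then a + D else a) :
    exec sec' a' (σ.shift D I) c = (exec sec a σ c).shift D I := by
  unfold exec
  by_cases he : c.Enabled σ
  swap
  · rw [if_neg he, if_neg (by rwa [Cmd.enabled_shift])]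
  rw [if_pos he, if_pos (by rwa [Cmd.enabled_shift])]
  cases c with
  | corrupt i => rfl
  | inject p =>
    have h1 : p.src ∈ σ.corrupted := he
    have : Packet.shift D I p = p := by
      simp only [Packet.shift]
      rw [Msg.shift_eq_self (fun h => hd (h ▸ h1)) (hD _ h1)]
    simp [State.shift, this]
  | deliver m =>
    have hm : (σ.shift D I).net[m]? = (σ.net[m]?).map (Packet.shift D I) := by
      simp [State.shift]
    simp only [hm]
    cases σ.net[m]? with
    | none => rfl
    | some p =>
      simp only [Option.map_some, State.shift_local, List.map_nil]
      exact congrArg (fun L => (σ.shift D I).local p.dst (L, []))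
        (Local.receive_shift p.src p.msg)
  | call k c =>
    have ha' : a' = if c = .deal I then a + D else a := by
      simp only [he, and_true, Cmd.call.injEq, exists_eq_left'] at ha
      exact ha
    have := Call.run_shift (L := σ.loc k) hsec hI a c he.2
    simp only [State.shift_local, ha']
    rw [← this]
    rfl
  | rule k ρ =>
    have := Rule.run_shift (I := I) (D := D) ρ he.2 fun h => hr k (h ▸ rfl) he
    simp only [State.shift_local]
    rw [← this]
    rfl

end Shift

/-! ### Coupling of executions with two secrets. -/

section Play

variable {n t : ℕ} {K : Type} [Field K] {sec sec' : Inst n → K} {A : Adversary n t K}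

lemma play_succ {N : ℕ} (coins : Fin (N + 1) → SPoly t K) :
    play sec A coins =
      playStep sec A (play sec A fun i => coins i.castSucc) (coins (Fin.last N)) := by
  simp only [play]
  rw [List.ofFn_succ', List.concat_eq_append, List.foldl_append]
  rfl

lemma play_inv {N : ℕ} (coins : Fin N → SPoly t K) : GInv sec (play sec A coins).1 := by
  induction N with
  | zero => exact .start _
  | succ N ih => rw [play_succ]; exact ((ih _).exec _ _).1

lemma play_length {N : ℕ} (coins : Fin N → SPoly t K) : (play sec A coins).2.length = N := by
  induction N with
  | zero => rfl
  | succ N ih => rw [play_succ, playStep, List.length_append, ih]; rfl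

/-- The controlled set is a function of the view, so one `D` works for all random choices that lead
to the same view. -/
lemma play_corrupted {N : ℕ} (coins : Fin N → SPoly t K) :
    (play sec A coins).1.corrupted = ((play sec A coins).2.getLast?.map Obs.corrupted).getD ∅ := by
  cases N with
  | zero => rfl
  | succ N => rw [play_succ]; simp [playStep]

/-- According to the view `w`, the dealer of `I` has dealt in step `i`. -/
def DealtAt (A : Adversary n t K) (I : Inst n) (w : List (Obs n t K)) (i : ℕ) : Prop :=
  (∃ k, A (w.take i) = .call k (.deal I)) ∧ ∃ o, w[i]? = some o ∧ o.ok

/-- Add `D` to the random choice of the dealer of `I`. -/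
def shiftCoins (A : Adversary n t K) (D : SPoly t K) (I : Inst n) (w : List (Obs n t K)) {N : ℕ}
    (coins : Fin N → SPoly t K) : Fin N → SPoly t K :=
  fun i => if DealtAt A I w i then coins i + D else coins i

/-- The steps in which `D` is added are read off the fixed view `w`, not off the coins, so the map
is a translation. -/
lemma shiftCoins_injective (D : SPoly t K) (I : Inst n) (w : List (Obs n t K)) (N : ℕ) :
    Function.Injective (shiftCoins A D I w (N := N)) := by
  intro c c' h
  funext i
  have := congrFun h i
  simp only [shiftCoins] at this
  split_ifs at this with hi
  · exact add_right_cancel this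
  · exact this

/-- As long as `I` is sealed, the adversary does not notice that `D` is added to the polynomial of
the dealer of `I`. -/
lemma play_shift {D : SPoly t K} {I : Inst n} {C : Finset (Fin n)}
    (hsec : ∀ J, J ≠ I → sec J = sec' J) (hI : sec' I = sec I + D s(0, 0)) (hdC : I.dealer ∉ C)
    (hD : ∀ i ∈ C, D.slice (pt K i) = 0) (w : List (Obs n t K)) {N : ℕ}
    (coins : Fin N → SPoly t K) (hw : (play sec A coins).2 = w.take N)
    (hC : (play sec A coins).1.corrupted ⊆ C)
    (hcast : ∀ k, k ∉ C → ((play sec A coins).1.loc k).cast (.poly I) = none) :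
    play sec' A (shiftCoins A D I w coins) =
      ((play sec A coins).1.shift D I, (play sec A coins).2) := by
  induction N with
  | zero => simp [play, State.shift_start]
  | succ N ih =>
    set coins₀ : Fin N → SPoly t K := fun i => coins i.castSucc with hcoins₀
    have hplay := play_succ (sec := sec) (A := A) coins
    rw [← hcoins₀] at hplay
    have hinv₀ := play_inv (sec := sec) (A := A) coins₀
    have hlen₀ := play_length (sec := sec) (A := A) coins₀
    rcases hσ : play sec A coins₀ with ⟨σ, u⟩
    rw [hσ] at hinv₀ hplay hlen₀
    simp only at hinv₀ hlen₀
    have hexec := hinv₀.exec (coins (Fin.last N)) (A u)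
    rw [hplay] at hw hC hcast ⊢
    simp only [playStep] at hw hC hcast
    set c := A u with hc
    set σ' := exec sec (coins (Fin.last N)) σ c with hσ'
    have hu : u = w.take N := by
      have := congrArg (List.take N) hw
      rwa [List.take_append_of_le_length hlen₀.ge, List.take_of_length_le hlen₀.le,
        List.take_take, min_eq_left (Nat.le_succ N)] at this
    have hok : ∃ o, w[N]? = some o ∧ o.ok = c.Enabled σ := by
      have h1 := congrArg (fun l => l[N]?) hw
      simp only [List.getElem?_take_of_lt (Nat.lt_succ_self N)] at h1
      rw [List.getElem?_append_right hlen₀.le, hlen₀, Nat.sub_self] at h1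
      exact ⟨_, h1.symm, rfl⟩
    have hC₀ : σ.corrupted ⊆ C := hexec.2.corrupted.trans hC
    have hcast₀ : ∀ k, k ∉ C → (σ.loc k).cast (.poly I) = none := by
      intro k hk
      by_contra hne
      obtain ⟨v, hv⟩ := Option.ne_none_iff_exists'.1 hne
      have := (hexec.2.loc k).cast _ _ hv
      rw [hcast k hk] at this
      cases this
    have hih := ih coins₀ (by rw [hσ]; exact hu) (by rw [hσ]; exact hC₀) (by rw [hσ]; exact hcast₀)
    rw [hσ] at hih
    simp only at hih
    have hlast : shiftCoins A D I w coins (Fin.last N) =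
        if (∃ k, c = .call k (.deal I)) ∧ c.Enabled σ then coins (Fin.last N) + D
        else coins (Fin.last N) := by
      obtain ⟨o, ho, hoe⟩ := hok
      have : DealtAt A I w N ↔ (∃ k, c = .call k (.deal I)) ∧ c.Enabled σ := by
        simp only [DealtAt, ← hu, ← hc, ho, Option.some.injEq, exists_eq_left', hoe]
      simp only [shiftCoins, Fin.val_last, this]
    have hex : exec sec' (shiftCoins A D I w coins (Fin.last N)) (σ.shift D I) c =
        σ'.shift D I := by
      refine exec_shift hsec hI _ _ σ c (fun h => hdC (hC₀ h)) (fun i hi => hD i (hC₀ hi)) ?_ hlast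
      intro k hck hen
      -- A process outside `C` cannot reveal in this step, because its A-Cast would break the seal.
      by_cases hk : k ∈ C
      · exact hD k hk
      · have h1 := hcast k hk
        rw [hck] at hen
        obtain ⟨f, hf⟩ := Option.ne_none_iff_exists'.1 hen.2.2.2.2.1
        rw [hσ', hck, exec, if_pos hen] at h1
        simp [State.local, Rule.run, hf, Local.acast] at h1
    rw [play_succ]
    have hcs : (fun i : Fin N => shiftCoins A D I w coins i.castSucc) =
        shiftCoins A D I w coins₀ := rfl
    rw [hcs, hih]
    simp only [playStep, ← hc, hex, Prod.mk.injEq, true_and, ← hσ']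
    congr 2
    simp only [Obs.mk.injEq]
    refine ⟨propext (Cmd.enabled_shift σ c), rfl, ?_, ?_⟩
    · funext i
      show (if i ∈ σ'.corrupted then some ((σ'.loc i).shift D I i) else none) = _
      by_cases hi : i ∈ σ'.corrupted
      · rw [if_pos hi, if_pos hi, Local.shift_eq_self _ (hD i (hC hi))]
        by_contra hne
        obtain ⟨F, hF⟩ := Option.ne_none_iff_exists'.1 hne
        exact hdC (((hexec.1.loc i).dealt I F hF).1 ▸ hC hi)
      · rw [if_neg hi, if_neg hi]
    · simp [State.shift, Packet.shift, Function.comp_def]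

/-- The coins are uniform, so it suffices to inject the favourable coins for one secret into those
for the other. The polynomial `D` is built from the final controlled set, hence vanishes also at
processes that are captured only later. -/
lemma sealedViewProb_le [Fintype K] (hK : Set.InjOn (fun m : ℕ => (m : K)) (Set.Iic n)) {I : Inst n}
    (hsec : ∀ J, J ≠ I → sec J = sec' J) (N : ℕ) (w : List (Obs n t K)) :
    sealedViewProb sec A N I w ≤ sealedViewProb sec' A N I w := by
  unfold sealedViewProb
  rw [PMF.toOuterMeasure_uniformOfFintype_apply, PMF.toOuterMeasure_uniformOfFintype_apply]
  refine ENNReal.div_le_div_right (Nat.cast_le.2 ?_) _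
  by_cases hne : ∃ coins : Fin N → SPoly t K,
      (play sec A coins).2 = w ∧ (play sec A coins).1.Sealed I
  swap
  · rw [Fintype.card_eq_zero_iff.2 ⟨fun x => hne ⟨x.1, x.2⟩⟩]
    exact Nat.zero_le _
  obtain ⟨coins₀, hw₀, hs₀⟩ := hne
  set C := (play sec A coins₀).1.corrupted with hC
  obtain ⟨g, hg0, hg⟩ := exists_spoly_vanishing (t := t) (pt_ne_zero (n := n) hK)
    (play_inv (sec := sec) (A := A) coins₀).card
  -- The vanishing polynomial with constant coefficient `1`, scaled to the difference of the
  -- secrets.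
  let D : SPoly t K := fun e => (sec' I - sec I) * g e
  have hD : ∀ i ∈ C, D.slice (pt K i) = 0 := by
    intro i hi
    funext q
    have := congrFun (hg i hi) q
    simp only [SPoly.slice] at this ⊢
    simp only [D, mul_assoc, ← Finset.mul_sum, this]
    simp
  have hI : sec' I = sec I + D s(0, 0) := by simp [D, hg0]
  refine Fintype.card_le_of_injective
    (fun x => ⟨shiftCoins A D I w x.1, ?_⟩) ?_
  · obtain ⟨coins, hw, hs⟩ := x
    have hCeq : (play sec A coins).1.corrupted = C := by
      rw [hC, play_corrupted, play_corrupted, hw, hw₀]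
    have hlen := play_length (sec := sec) (A := A) coins
    have := play_shift hsec hI hs₀.1 hD w coins
      (by rw [hw, List.take_of_length_le (by rw [← hw, hlen])]) hCeq.subset
      (fun k hk => hs.2 k (hCeq ▸ hk))
    show _ ∧ _
    rw [this]
    exact ⟨hw, hs.1, hs.2⟩
  · intro x y h
    exact Subtype.ext (shiftCoins_injective D I w N (congrArg Subtype.val h))

lemma secrecy [Fintype K] (hK : Set.InjOn (fun m : ℕ => (m : K)) (Set.Iic n)) (I : Inst n) :
    Secrecy n t K I := fun _ _ _ hsec N w =>
  le_antisymm (sealedViewProb_le hK hsec N w)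
    (sealedViewProb_le hK (fun J hJ => (hsec J hJ).symm) N w)

end Play

end

end IVSS

theorem mainTheorem4 (n t : ℕ) (hn : 3 * t < n) (K : Type) [Field K]
    (hK : Set.InjOn (fun m : ℕ => (m : K)) (Set.Iic n)) (I : IVSS.Inst n) (hI : 1 ≤ I.round) :
    (IVSS.Termination1 n t K I ∧ IVSS.Termination2 n t K I ∧
      IVSS.Termination3 n t K I ∧ IVSS.Termination4 n t K I) ∧
    IVSS.Correctness n t K I ∧
    (∀ [Fintype K], IVSS.Secrecy n t K I) :=
  ⟨⟨IVSS.termination1 hn I, IVSS.termination2 hn I, IVSS.termination3 hK hn I,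
    IVSS.termination4 hn I⟩, IVSS.correctness hK hn I, IVSS.secrecy hK I⟩
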